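/- Let $n\ge 1$ and let $M$ be a nonempty compact (Hausdorff) smooth manifold of real dimension $2n+1\ge 3$ with a CR structure of hypersurface type: a smooth complex subbundle $T^{1,0}\subset\mathbb C\otimes TM$ of rank $n$ with $T^{1,0}\cap T^{0,1}=\{0\}$, where $T^{0,1}=\overline{T^{1,0}}$, and $[\Gamma(T^{0,1}),\Gamma(T^{0,1})]\subset\Gamma(T^{0,1})$. A trivialization is a smooth, purely imaginary, nowhere vanishing 1-form $\eta$ on $M$ (extended complex linearly) that annihilates $T^{1,0}\oplus T^{0,1}$. Its Levi form is $\lambda_\eta(L,L')=\eta([L,\overline{L'}])$ for $L,L'\in\Gamma(T^{1,0})$, and $\eta$ is positive if $\lambda_\eta(L,L)\ge 0$ for all $L$. Let $\mathcal N_p\subset T^{1,0}_p$ be the kernel of the Levi form at $p$, i.e. the set of $L_p \in T^{1,0}_p$ with $[L,\overline{L'}]_p\in T^{1,0}_p\oplus T^{0,1}_p$ for all $L'\in\Gamma(T^{1,0})$ and all extensions $L \in \Gamma(T^{1,0})$ of $L_p$ (equivalently $\lambda_\eta(L_p,\cdot)=0$ for any trivialization $\eta$). $M$ is Levi-flat if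 $\mathcal N_p=T^{1,0}_p$ for every $p\in M$. Let $T$ be a smooth purely imaginary vector field with $\eta(T)=1$, and put $\alpha_\eta(X)=-d\eta(T,X)$, so that $\alpha_\eta(L)=\eta([T,L])$ for $L\in\Gamma(T^{1,0})$. The D'Angelo $(1,0)$-form $\omega_\eta$ is the complex linear form on $\mathbb C\otimes TM$ that equals $\alpha_\eta$ on $T^{1,0}$ and vanishes on $T^{0,1}\oplus\mathbb CT$. For $L,L'\in\Gamma(T^{1,0})$ put $$\overline\partial_b\omega_\eta(L,\overline{L'})=\varepsilon\bigl(\overline{L'}\,(\omega_\eta(L))+\omega_\eta([L,\overline{L'}])\bigr),\qquad (\omega_\eta\wedge\overline{\omega}_\eta)(L,\overline{L})=|\omega_\eta(L)|^2,$$ where $\varepsilon\in\{1,-1\}$ is a fixed choice of sign convention ($\varepsilon=-1$ is the convention of the exterior derivative). Restricted to $\mathcal N$, these forms do not depend on the choice of $T$. The Steinness index of $M$ in the strong sense, $S_s(M)\in[1,\infty]$, is the infimum of all $\gamma>1$ for which there is a positive trivialization $\eta$ with $$-\overline\partial_b\omega_\eta(L,\overline L)-\frac{\gamma}{\gamma-1}\,(\omega_\eta\wedge\overline\omega_\eta)(L,\overline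 L)>0\qquad\text{for all } p \in M \text{ and } 0\ne L\in\mathcal N_p ,$$ and $S_s(M)=\infty$ if there is no such $\gamma$. **Proposition.** If $M$ is Levi-flat, then $S_s(M)=\infty$, for either choice of the sign $\varepsilon$. -/

import Mathlib

open scoped Manifold ContDiff TensorProduct Topology

set_option linter.unusedSectionVars false

noncomputable section

namespace LeviCR

/-- The model space of a real manifold of dimension `2 n + 1`. -/
abbrev Model (n : ℕ) : Type := EuclideanSpace ℝ (Fin (2 * n + 1))

section Defs

variable (n : ℕ) (M : Type*) [TopologicalSpace M] [ChartedSpace (Model n) M]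
  [IsManifold 𝓘(ℝ, Model n) ∞ M]

/-- The real tangent space at `p`. -/
abbrev RTangent (p : M) : Type := TangentSpace 𝓘(ℝ, Model n) p

/-- The fibre `ℂ ⊗ T_p M` of the complexified tangent bundle. -/
abbrev CTangent (p : M) : Type := ℂ ⊗[ℝ] RTangent n M p

/-- Complex conjugation `z ⊗ v ↦ conj z ⊗ v` on `ℂ ⊗ T_p M`. -/
def conjC (p : M) : CTangent n M p →ₛₗ[starRingEnd ℂ] CTangent n M p where
  toFun := LinearMap.rTensor (RTangent n M p) Complex.conjAe.toLinearMap
  map_add' := map_add _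
  map_smul' := by
    intro z v
    induction v using TensorProduct.induction_on with
    | zero => simp
    | tmul w v => simp [TensorProduct.smul_tmul']
    | add a b ha hb => rw [smul_add, map_add, ha, hb, map_add, smul_add]

/-- Smooth sections `re + i im` of `ℂ ⊗ TM`. -/
structure CVectorField where
  re : ∀ p : M, RTangent n M p
  im : ∀ p : M, RTangent n M p
  smooth_re : ContMDiff 𝓘(ℝ, Model n) (𝓘(ℝ, Model n)).tangent ∞
    (fun p => (⟨p, re p⟩ : TangentBundle 𝓘(ℝ, Model n) M))
  smooth_im : ContMDiff 𝓘(ℝ, Model n) (𝓘(ℝ, Model n)).tangent ∞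
    (fun p => (⟨p, im p⟩ : TangentBundle 𝓘(ℝ, Model n) M))

variable {n M}

/-- The value at `p` of a complex vector field. -/
def CVectorField.val (X : CVectorField n M) (p : M) : CTangent n M p :=
  (1 : ℂ) ⊗ₜ[ℝ] X.re p + Complex.I ⊗ₜ[ℝ] X.im p

/-- The conjugate vector field. -/
def CVectorField.conj (X : CVectorField n M) :
    CVectorField n M where
  re := X.re
  im := -X.im
  smooth_re := X.smooth_re
  smooth_im := X.smooth_im.neg_section

/-- The value at `p` of the Lie bracket, extended complex bilinearly from real vector fields:
`[A + i B, C + i D] = ([A, C] - [B, D]) + i ([A, D] + [B, C])`. -/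
def bracket (X Y : CVectorField n M) (p : M) : CTangent n M p :=
  (1 : ℂ) ⊗ₜ[ℝ] (VectorField.mlieBracket 𝓘(ℝ, Model n) X.re Y.re p
      - VectorField.mlieBracket 𝓘(ℝ, Model n) X.im Y.im p) +
    Complex.I ⊗ₜ[ℝ] (VectorField.mlieBracket 𝓘(ℝ, Model n) X.re Y.im p
      + VectorField.mlieBracket 𝓘(ℝ, Model n) X.im Y.re p)

/-- The real differential at `p` of a complex function. -/
def realDiff (f : M → ℂ) (p : M) : RTangent n M p →L[ℝ] ℂ :=
  mfderiv 𝓘(ℝ, Model n) 𝓘(ℝ, ℂ) f p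

/-- The derivative at `p` of a complex function `f` along a complex vector field `X`. -/
def CVectorField.deriv (X : CVectorField n M) (f : M → ℂ) (p : M) : ℂ :=
  realDiff f p (X.re p) + Complex.I * realDiff f p (X.im p)

variable (n M) in
/-- A CR structure of hypersurface type on a manifold of real dimension `2 n + 1`: a smooth complex
subbundle `T10` of `ℂ ⊗ TM` of rank `n` which meets its conjugate only in the zero section,
and whose conjugate is involutive. -/
structure CRStructure where
  T10 : ∀ p : M, Submodule ℂ (CTangent n M p)
  frame : ∀ p : M, ∃ L : Fin n → CVectorField n M, ∀ᶠ q in 𝓝 p,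
    LinearIndependent ℂ (fun i => (L i).val q) ∧
      Submodule.span ℂ (Set.range fun i => (L i).val q) = T10 q
  disjoint : ∀ p : M, Disjoint (T10 p) ((T10 p).comap (conjC n M p))
  integrable : ∀ X Y : CVectorField n M,
    (∀ p, X.val p ∈ (T10 p).comap (conjC n M p)) →
    (∀ p, Y.val p ∈ (T10 p).comap (conjC n M p)) →
    ∀ p, bracket X Y p ∈ (T10 p).comap (conjC n M p)

namespace CRStructure

variable (S : CRStructure n M)

/-- `T^{0,1}`, the conjugate of `T^{1,0}`. -/
def T01 (p : M) : Submodule ℂ (CTangent n M p) := (S.T10 p).comap (conjC n M p)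

/-- `X` is a smooth section of `T^{1,0}`. -/
def IsSection10 (X : CVectorField n M) : Prop := ∀ p, X.val p ∈ S.T10 p

/-- A trivialization of `ℂ ⊗ TM / (T^{1,0} ⊕ T^{0,1})`: a smooth, purely imaginary, nowhere
vanishing 1-form (extended complex linearly to `ℂ ⊗ TM`) which annihilates
`T^{1,0} ⊕ T^{0,1}`. -/
structure Trivialization where
  form : ∀ p : M, RTangent n M p →L[ℝ] ℂ
  smooth : ContMDiff 𝓘(ℝ, Model n) (𝓘(ℝ, Model n).prod 𝓘(ℝ, Model n →L[ℝ] ℂ)) ∞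
    (fun p => Bundle.TotalSpace.mk' (Model n →L[ℝ] ℂ)
      (E := fun p : M => RTangent n M p →L[ℝ] Bundle.Trivial M ℂ p) p (form p))
  imaginary : ∀ p v, (form p v).re = 0
  nonvanishing : ∀ p, form p ≠ 0
  annihilates : ∀ p, ∀ v ∈ S.T10 p ⊔ S.T01 p,
    LinearMap.liftBaseChange ℂ (form p : RTangent n M p →ₗ[ℝ] ℂ) v = 0

variable {S}

/-- The complex linear extension of `η` to `ℂ ⊗ T_p M`. -/
def Trivialization.ext (η : S.Trivialization) (p : M) : CTangent n M p →ₗ[ℂ] ℂ :=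
  LinearMap.liftBaseChange ℂ (η.form p : RTangent n M p →ₗ[ℝ] ℂ)

/-- The exterior derivative `dη (X, Y) = X η(Y) - Y η(X) - η([X, Y])`. -/
def Trivialization.extDeriv (η : S.Trivialization) (X Y : CVectorField n M) (p : M) : ℂ :=
  X.deriv (fun q => η.ext q (Y.val q)) p - Y.deriv (fun q => η.ext q (X.val q)) p
    - η.ext p (bracket X Y p)

/-- The Levi form `λ_η (L, L') = η([L, conj L'])`, for sections `L`, `L'` of `T^{1,0}`. -/
def Trivialization.leviForm (η : S.Trivialization) (L L' : CVectorField n M) (p : M) : ℂ :=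
  η.ext p (bracket L L'.conj p)

/-- `η` is positive if its Levi form is positive semi-definite at every point. -/
def Trivialization.IsPositive (η : S.Trivialization) : Prop :=
  ∀ L : CVectorField n M, S.IsSection10 L → ∀ p, 0 ≤ (η.leviForm L L p).re

variable (S) in
/-- The kernel of the Levi form at `p`, where the Levi form is regarded as taking its values in
`ℂ ⊗ TM / (T^{1,0} ⊕ T^{0,1})`, so that no trivialization has to be chosen. -/
def leviNull (p : M) : Set (CTangent n M p) :=
  {v | v ∈ S.T10 p ∧ ∀ L L' : CVectorField n M, S.IsSection10 L → S.IsSection10 L' →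
    L.val p = v → bracket L L'.conj p ∈ S.T10 p ⊔ S.T01 p}

variable (S) in
/-- The CR structure is Levi-flat if the kernel of the Levi form is all of `T^{1,0}`. -/
def IsLeviFlat : Prop := ∀ p : M, S.leviNull p = (S.T10 p : Set (CTangent n M p))

/-- A transversal vector field normalized with respect to `η`: a purely imaginary vector field
`T` with `η(T) = 1`. -/
structure Trivialization.IsTransversal (η : S.Trivialization) (T : CVectorField n M) : Prop where
  imaginary : ∀ p, T.re p = 0
  normalized : ∀ p, η.ext p (T.val p) = 1

/-- The D'Angelo 1-form `α_η (X) = - dη (T, X)`. -/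
def Trivialization.alpha (η : S.Trivialization) (T X : CVectorField n M) (p : M) : ℂ :=
  -η.extDeriv T X p

open Classical in
/-- The D'Angelo `(1,0)`-form `ω_η` on `ℂ ⊗ T_p M`: the value of `α_η` on the
`T^{1,0}`-component of `v` in the decomposition `T^{1,0} ⊕ T^{0,1} ⊕ ℂ T`. This component is
extended to a section `L` of `T^{1,0}`; the value does not depend on the extension. -/
def Trivialization.omega (η : S.Trivialization) (T : CVectorField n M) (p : M)
    (v : CTangent n M p) : ℂ :=
  if h : ∃ L : CVectorField n M, S.IsSection10 L ∧
      v - L.val p ∈ S.T01 p ⊔ Submodule.span ℂ {T.val p} then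
    η.alpha T h.choose p
  else 0

/-- The `(1,1)`-form `∂̄_b ω_η`, evaluated on `(L, conj L')` for sections `L`, `L'` of `T^{1,0}`:
`ε (conj L' (ω_η (L)) + ω_η ([L, conj L']))`. Both sign conventions `ε = 1` and `ε = -1`
are allowed; `ε = -1` is the one of the exterior derivative,
`dω (L, conj L') = L (ω (conj L')) - conj L' (ω (L)) - ω ([L, conj L'])`
with `ω (conj L') = 0`. -/
def Trivialization.dbarOmega (ε : ℤˣ) (η : S.Trivialization) (T L L' : CVectorField n M) (p : M) :
    ℂ :=
  ((ε : ℤ) : ℂ) * (L'.conj.deriv (fun q => η.omega T q (L.val q)) p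
    + η.omega T p (bracket L L'.conj p))

/-- `- ∂̄_b ω_η - γ / (γ - 1) ω_η ∧ conj ω_η > 0` as a hermitian form on the kernel of the
Levi form, where `(ω_η ∧ conj ω_η) (L, conj L) = |ω_η (L)|²`. -/
def Trivialization.IsSteinnessExponent (ε : ℤˣ) (η : S.Trivialization) (T : CVectorField n M)
    (γ : ℝ) : Prop :=
  ∀ p : M, ∀ L : CVectorField n M, S.IsSection10 L → L.val p ∈ S.leviNull p → L.val p ≠ 0 →
    0 < (-η.dbarOmega ε T L L p
      - ((γ / (γ - 1) : ℝ) : ℂ) * (η.omega T p (L.val p)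
          * (starRingEnd ℂ) (η.omega T p (L.val p)))).re

variable (S) in
/-- The Steinness index in the strong sense: the infimum of all `γ > 1` for which some positive
trivialization `η`, with some normalized transversal vector field `T` (the condition does not
depend on `T`), satisfies the strict inequality; it is `⊤` if there is no such `γ`. -/
def strongSteinnessIndex (ε : ℤˣ) : EReal :=
  sInf ((fun γ : ℝ => (γ : EReal)) '' {γ : ℝ | 1 < γ ∧ ∃ η : S.Trivialization, η.IsPositive ∧
    ∃ T : CVectorField n M, η.IsTransversal T ∧ η.IsSteinnessExponent ε T γ})

end CRStructure

theorem conjC_tmul (p : M) (z : ℂ) (v : RTangent n M p) :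
    conjC n M p (z ⊗ₜ[ℝ] v) = (starRingEnd ℂ z) ⊗ₜ[ℝ] v := by
  simp [conjC]

theorem conjC_conjC (p : M) (v : CTangent n M p) : conjC n M p (conjC n M p v) = v := by
  induction v using TensorProduct.induction_on with
  | zero => simp
  | tmul w v => simp [conjC_tmul]
  | add a b ha hb => rw [map_add, map_add, ha, hb]

theorem val_conj (X : CVectorField n M) (p : M) : X.conj.val p = conjC n M p (X.val p) := by
  simp [CVectorField.val, CVectorField.conj, conjC_tmul, TensorProduct.neg_tmul,
    TensorProduct.tmul_neg]

namespace CRStructure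

variable {S : CRStructure n M}

/-- The kernel of a trivialization is exactly `T^{1,0} ⊕ T^{0,1}`. -/
theorem Trivialization.ker_ext (η : S.Trivialization) (p : M) :
    LinearMap.ker (η.ext p) = S.T10 p ⊔ S.T01 p := by
  have : FiniteDimensional ℝ (RTangent n M p) :=
    inferInstanceAs (FiniteDimensional ℝ (EuclideanSpace ℝ (Fin (2 * n + 1))))
  have hV : Module.finrank ℂ (CTangent n M p) = 2 * n + 1 := by
    rw [Module.finrank_baseChange]
    exact finrank_euclideanSpace_fin
  obtain ⟨L, hL⟩ := S.frame p
  obtain ⟨hli, hspan⟩ := hL.self_of_nhds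
  have h10 : Module.finrank ℂ (S.T10 p) = n := by
    rw [← hspan, finrank_span_eq_card hli, Fintype.card_fin]
  have hli' : LinearIndependent ℂ (fun i => conjC n M p ((L i).val p)) := by
    refine hli.map_of_injective_injectiveₛ (starRingEnd ℂ)
      (conjC n M p).toAddMonoidHom (starRingEnd ℂ).injective ?_ ?_
    · intro a b h
      rw [← conjC_conjC p a, ← conjC_conjC p b]
      exact congrArg _ h
    · intro r m
      simp
  have h01 : n ≤ Module.finrank ℂ (S.T01 p) := by
    have h : Submodule.span ℂ (Set.range fun i => conjC n M p ((L i).val p)) ≤ S.T01 p := by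
      rw [Submodule.span_le]
      rintro _ ⟨i, rfl⟩
      change conjC n M p (conjC n M p ((L i).val p)) ∈ S.T10 p
      rw [conjC_conjC, ← hspan]
      exact Submodule.subset_span ⟨i, rfl⟩
    have := Submodule.finrank_mono h
    rwa [finrank_span_eq_card hli', Fintype.card_fin] at this
  have hsum := Submodule.finrank_sup_add_finrank_inf_eq (S.T10 p) (S.T01 p)
  rw [show S.T10 p ⊓ S.T01 p = ⊥ from (S.disjoint p).eq_bot, finrank_bot] at hsum
  have hne : η.ext p ≠ 0 := by
    intro h
    apply η.nonvanishing p
    ext v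
    have := LinearMap.congr_fun h ((1 : ℂ) ⊗ₜ[ℝ] v)
    simpa [Trivialization.ext] using this
  have hker := (η.ext p).finrank_range_add_finrank_ker
  rw [LinearMap.range_eq_top.2 (LinearMap.surjective_of_ne_zero hne), finrank_top, hV,
    Module.finrank_self] at hker
  symm
  apply Submodule.eq_of_le_of_finrank_le
  · exact fun v hv => η.annihilates p v hv
  · omega

/-- In terms of any trivialization, `leviNull` is the kernel of the Levi form `λ_η`. -/
theorem mem_leviNull_iff (η : S.Trivialization) (p : M) (v : CTangent n M p) :
    v ∈ S.leviNull p ↔ v ∈ S.T10 p ∧ ∀ L L' : CVectorField n M, S.IsSection10 L →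
      S.IsSection10 L' → L.val p = v → η.leviForm L L' p = 0 := by
  simp only [leviNull, Set.mem_ofPred_eq, ← η.ker_ext, LinearMap.mem_ker, Trivialization.leviForm]

/-- On sections of `T^{1,0}` the D'Angelo 1-form is `η([T, L])`. -/
theorem Trivialization.alpha_eq (η : S.Trivialization) {T L : CVectorField n M}
    (hT : η.IsTransversal T) (hL : S.IsSection10 L) (p : M) :
    η.alpha T L p = η.ext p (bracket T L p) := by
  have h1 : (fun q => η.ext q (L.val q)) = fun _ => 0 :=
    funext fun q => η.annihilates q _ (Submodule.mem_sup_left (hL q))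
  have h2 : (fun q => η.ext q (T.val q)) = fun _ => 1 := funext hT.normalized
  have hd : ∀ (X : CVectorField n M) (c : ℂ), X.deriv (fun _ => c) p = 0 := by
    intro X c
    have : realDiff (n := n) (fun _ : M => c) p = 0 := mfderiv_const
    simp [CVectorField.deriv, this]
  simp [Trivialization.alpha, Trivialization.extDeriv, h1, h2, hd]

end CRStructure

end Defs

end LeviCR

end

/-! Write η = i h and T = i W with h and W real, so that h(W) = -1, and put α = dh(W, ·).
Levi-flatness and integrability of the CR structure make the hyperplane field ker h involutive.
Taking real parts identifies T^{1,0} with ker h, so ω_η is encoded by a real 1-form θ with θ(W) = 0: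
for L = X + iY in T^{1,0} one has θ(X) = α(Y), θ(Y) = -α(X) and ω_η(L) = -θ(Y) + iθ(X). Then Re ∂̄_b
ω_η(L, L̄) = -ε dθ(X, Y) (`re_dbarOmega`), and the Steinness condition reads ε dθ(X, Y) > c (θ(X)² +
θ(Y)²) for L ≠ 0, where c = γ/(γ-1) > 1.

Hence dθ is nondegenerate on ker h, and there is a Liouville field X in ker h with dθ(X, ·) = θ on
ker h. Involutivity gives dh(X, ·) = λ h. The Lie derivative along X multiplies dθ by 1 modulo h and
multiplies h by λ, so the volume h ∧ (dθ)^n has divergence n + λ along X. On a nonempty compact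
manifold a divergence integrates to zero, so n + λ cannot be positive everywhere
(`false_of_liouville_expanding`).

On the other hand λ = α(X), by evaluation on W. If X ≠ 0 and L = X + iY is the corresponding vector
of T^{1,0}, then dθ(X, Y) = θ(Y) = -λ, so the inequality gives cλ² < |λ|, whence |λ| < 1 ≤ n. Where
X = 0, also λ = 0. Thus n + λ > 0 everywhere, a contradiction for either sign ε.

Orientations and exterior powers are avoided: up to a constant, |h ∧ (dθ)^n| is the density √|det G|
of the bilinear form G = dθ + h ⊗ h. Its divergence is computed in coordinates in
`divergence_gramDensity_smul`, and `DensityField.false_of_divergence_pos` is the global divergence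
argument. -/

set_option maxSynthPendingDepth 3

namespace LeviCR

open MeasureTheory Set Function

/-! ### The divergence theorem for compactly supported fields on a vector space. -/

section Divergence

variable {E : Type*} [NormedAddCommGroup E] [NormedSpace ℝ E] [FiniteDimensional ℝ E]

/-- The divergence of a vector field on a finite-dimensional vector space. -/
noncomputable def divergence (F : E → E) (x : E) : ℝ :=
  LinearMap.trace ℝ E (fderiv ℝ F x : E →ₗ[ℝ] E)

theorem continuous_divergence {F : E → E} (hF : ContDiff ℝ 1 F) : Continuous (divergence F) := by
  have h : Continuous fun A : E →L[ℝ] E => LinearMap.trace ℝ E (A : E →ₗ[ℝ] E) :=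
    ((LinearMap.trace ℝ E).comp (ContinuousLinearMap.coeLM ℝ)).continuous_of_finiteDimensional
  exact h.comp (hF.continuous_fderiv one_ne_zero)

theorem support_divergence_subset (F : E → E) : support (divergence F) ⊆ tsupport F := by
  intro x hx
  apply support_fderiv_subset ℝ
  intro h
  exact hx (by simp [divergence, h])

theorem divergence_smul {f : E → ℝ} {F : E → E} {x : E} (hf : DifferentiableAt ℝ f x)
    (hF : DifferentiableAt ℝ F x) :
    divergence (fun y => f y • F y) x = f x * divergence F x + fderiv ℝ f x (F x) := by
  rw [divergence, fderiv_fun_smul hf hF]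
  have : ((f x • fderiv ℝ F x + (fderiv ℝ f x).smulRight (F x) : E →L[ℝ] E) : E →ₗ[ℝ] E)
      = f x • (fderiv ℝ F x : E →ₗ[ℝ] E) + (fderiv ℝ f x : E →ₗ[ℝ] ℝ).smulRight (F x) := rfl
  rw [this, map_add, map_smul, LinearMap.trace_smulRight]
  rfl

variable [MeasurableSpace E] [BorelSpace E] (μ : Measure E) [μ.IsAddHaarMeasure]

theorem integral_fderiv_apply_eq_zero {f : E → ℝ} (hf : ContDiff ℝ 1 f)
    (hc : HasCompactSupport f) (v : E) : ∫ x, fderiv ℝ f x v ∂μ = 0 := by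
  have hcont : Continuous fun x => fderiv ℝ f x v :=
    (hf.continuous_fderiv one_ne_zero).clm_apply continuous_const
  have hint : Integrable (fun x => fderiv ℝ f x v) μ :=
    hcont.integrable_of_hasCompactSupport (hc.fderiv_apply ℝ v)
  -- Integration by parts against the constant function 1.
  have h := integral_mul_fderiv_eq_neg_fderiv_mul_of_integrable (𝕜 := ℝ) (μ := μ)
    (f := fun _ => (1 : ℝ)) (g := f) (v := v) (by simp) (by simpa using hint)
    (by simpa using hf.continuous.integrable_of_hasCompactSupport hc)
    (fun _ _ => differentiableAt_const _) (fun x _ => hf.differentiable one_ne_zero x)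
  simpa using h

theorem integral_divergence_eq_zero {F : E → E} (hF : ContDiff ℝ 1 F)
    (hc : HasCompactSupport F) : ∫ x, divergence F x ∂μ = 0 := by
  classical
  let b := Module.finBasis ℝ E
  let l : ∀ i, E →L[ℝ] ℝ := fun i => (b.coord i).toContinuousLinearMap
  have hl : ∀ i, ContDiff ℝ 1 fun y => l i (F y) := fun i => (l i).contDiff.comp hF
  have hlc : ∀ i, HasCompactSupport fun y => l i (F y) := fun i =>
    hc.comp_left (g := l i) (map_zero _)
  have h : ∀ x, divergence F x = ∑ i, fderiv ℝ (fun y => l i (F y)) x (b i) := by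
    intro x
    rw [divergence, LinearMap.trace_eq_matrix_trace ℝ b, Matrix.trace]
    refine Finset.sum_congr rfl fun i _ => ?_
    have := (l i).hasFDerivAt.comp x (hF.differentiable one_ne_zero x).hasFDerivAt
    have h2 : fderiv ℝ (fun y => l i (F y)) x = (l i).comp (fderiv ℝ F x) := this.fderiv
    rw [h2]
    simp [LinearMap.toMatrix_apply, l]
  simp_rw [h]
  rw [integral_finsetSum]
  · exact Finset.sum_eq_zero fun i _ => integral_fderiv_apply_eq_zero μ (hl i) (hlc i) _
  · intro i _
    exact (((hl i).continuous_fderiv one_ne_zero).clm_apply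
      continuous_const).integrable_of_hasCompactSupport ((hlc i).fderiv_apply ℝ _)

end Divergence

/-! ### Coordinate changes between preferred charts. -/

section Transition

variable {E : Type*} [NormedAddCommGroup E] [NormedSpace ℝ E]
  {M : Type*} [TopologicalSpace M] [ChartedSpace E M]

/-- The change of coordinates between the preferred charts at `c` and at `d`. -/
def transition (c d : M) : OpenPartialHomeomorph E E := (chartAt E c).symm ≫ₕ chartAt E d

theorem mem_transition_source {c d : M} {x : E} :
    x ∈ (transition c d).source ↔
      x ∈ (chartAt E c).target ∧ (chartAt E c).symm x ∈ (chartAt E d).source := by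
  simp [transition]

theorem transition_apply (c d : M) (x : E) :
    transition c d x = chartAt E d ((chartAt E c).symm x) := rfl

variable [IsManifold 𝓘(ℝ, E) ∞ M]

theorem contDiffAt_transition {c d : M} {x : E} (hx : x ∈ (transition c d).source) :
    ContDiffAt ℝ ∞ (transition c d) x := by
  have h := contDiffWithinAt_ext_coord_change (I := 𝓘(ℝ, E)) (n := ∞) d c (y := x)
    (by simpa [transition] using hx)
  have h' : ContDiffAt ℝ ∞ (chartAt E d ∘ (chartAt E c).symm) x := by
    simpa [contDiffWithinAt_univ] using h
  exact h'

theorem hasFDerivAt_transition {c d : M} {x : E} (hx : x ∈ (transition c d).source) :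
    HasFDerivAt (transition c d) (fderiv ℝ (transition c d) x) x :=
  ((contDiffAt_transition hx).differentiableAt (by simp)).hasFDerivAt

theorem contDiffAt_comp_chart_symm {F : Type*} [NormedAddCommGroup F] [NormedSpace ℝ F]
    {f : M → F} (hf : ContMDiff 𝓘(ℝ, E) 𝓘(ℝ, F) ∞ f) {c : M} {x : E}
    (hx : x ∈ (chartAt E c).target) : ContDiffAt ℝ ∞ (fun y => f ((chartAt E c).symm y)) x := by
  have h1 : ContMDiffAt 𝓘(ℝ, E) 𝓘(ℝ, E) ∞ (chartAt E c).symm x :=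
    (contMDiffOn_chart_symm (I := 𝓘(ℝ, E)) (n := ∞) (x := c)).contMDiffAt
      ((chartAt E c).open_target.mem_nhds hx)
  exact (hf.contMDiffAt.comp x h1).contDiffAt

end Transition

/-! ### Densities on a manifold and the divergence theorem inside one chart. -/

section GlobalDivergence

variable {E : Type*} [NormedAddCommGroup E] [NormedSpace ℝ E] [FiniteDimensional ℝ E]
  {M : Type*} [TopologicalSpace M] [ChartedSpace E M]

/-- A positive density `ρ` and a vector field `X`, given by their representations in the preferred
charts of a manifold. -/
structure DensityField (ρ : M → E → ℝ) (X : M → E → E) : Prop where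
  pos : ∀ c, ∀ x ∈ (chartAt E c).target, 0 < ρ c x
  density_smooth : ∀ c, ∀ x ∈ (chartAt E c).target, ContDiffAt ℝ 1 (ρ c) x
  field_smooth : ∀ c, ∀ x ∈ (chartAt E c).target, ContDiffAt ℝ 1 (X c) x
  density_change : ∀ c d : M, ∀ x ∈ (transition c d).source,
    ρ c x = |(fderiv ℝ (transition c d) x).det| * ρ d (transition c d x)
  field_change : ∀ c d : M, ∀ x ∈ (transition c d).source,
    X d (transition c d x) = fderiv ℝ (transition c d) x (X c x)

/-- The derivative at `q` of a function along a vector field given in charts. -/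
noncomputable def fieldDeriv (X : M → E → E) (f : M → ℝ) (q : M) : ℝ :=
  fderiv ℝ (fun y => f ((chartAt E q).symm y)) (chartAt E q q) (X q (chartAt E q q))

variable {ρ : M → E → ℝ} {X : M → E → E}

variable [IsManifold 𝓘(ℝ, E) ∞ M]

/-- `fieldDeriv` uses a different chart at each point. The chain rule and the transformation law of
the field allow one fixed chart to serve for all points of its domain. -/
theorem DensityField.fieldDeriv_eq (h : DensityField ρ X) {f : M → ℝ}
    (hf : ContMDiff 𝓘(ℝ, E) 𝓘(ℝ, ℝ) ∞ f) {c : M} {x : E} (hx : x ∈ (chartAt E c).target) :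
    fieldDeriv X f ((chartAt E c).symm x) =
      fderiv ℝ (fun y => f ((chartAt E c).symm y)) x (X c x) := by
  set q := (chartAt E c).symm x with hq
  have hxs : x ∈ (transition c q).source :=
    mem_transition_source.2 ⟨hx, mem_chart_source E q⟩
  have htx : transition c q x = chartAt E q q := rfl
  have hev : (fun y => f ((chartAt E c).symm y)) =ᶠ[𝓝 x]
      (fun y => f ((chartAt E q).symm y)) ∘ transition c q := by
    filter_upwards [(transition c q).open_source.mem_nhds hxs] with y hy
    simp only [comp_apply, transition_apply]
    rw [(chartAt E q).left_inv (mem_transition_source.1 hy).2]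
  have hfq := contDiffAt_comp_chart_symm hf (mem_chart_target E q)
  rw [hev.fderiv_eq, fderiv_comp x
    (by rw [htx]; exact hfq.differentiableAt (by simp))
    (hasFDerivAt_transition hxs).differentiableAt]
  rw [ContinuousLinearMap.comp_apply, ← h.field_change c q x hxs, htx]
  rfl

theorem DensityField.continuous_fieldDeriv (h : DensityField ρ X) {f : M → ℝ}
    (hf : ContMDiff 𝓘(ℝ, E) 𝓘(ℝ, ℝ) ∞ f) : Continuous (fieldDeriv X f) := by
  rw [continuous_iff_continuousAt]
  intro q
  have hev : fieldDeriv X f =ᶠ[𝓝 q] (fun x => fderiv ℝ (fun y => f ((chartAt E q).symm y)) x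
      (X q x)) ∘ chartAt E q := by
    filter_upwards [chart_source_mem_nhds E q] with p hp
    have := h.fieldDeriv_eq hf ((chartAt E q).map_source hp)
    rwa [(chartAt E q).left_inv hp] at this
  refine ContinuousAt.congr ?_ hev.symm
  refine ContinuousAt.comp ?_ ((chartAt E q).continuousAt (mem_chart_source E q))
  have h1 := contDiffAt_comp_chart_symm hf (mem_chart_target E q)
  have h2 := h.field_smooth q _ (mem_chart_target E q)
  exact ((h1.fderiv_right (m := ∞) le_rfl).continuousAt).clm_apply h2.continuousAt

theorem support_fieldDeriv_subset (f : M → ℝ) : support (fieldDeriv X f) ⊆ tsupport f := by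
  intro q hq
  by_contra hn
  apply hq
  have h0 : (fun y => f ((chartAt E q).symm y)) =ᶠ[𝓝 (chartAt E q q)] fun _ => 0 := by
    have := (chartAt E q).continuousAt_symm (mem_chart_target E q)
    rw [ContinuousAt, (chartAt E q).left_inv (mem_chart_source E q)] at this
    exact this.eventually (notMem_tsupport_iff_eventuallyEq.1 hn)
  simp [fieldDeriv, h0.fderiv_eq]

variable [MeasurableSpace E] [BorelSpace E] (μ : Measure E) [μ.IsAddHaarMeasure]

/-- Both integrals reduce to the overlap of the charts, since f vanishes elsewhere. There the change
of variables formula matches the factor |det| in the law for ρ, so no orientation is needed. -/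
theorem DensityField.setIntegral_eq (h : DensityField ρ X) {f : M → ℝ} {c d : M}
    (hc : support f ⊆ (chartAt E c).source) (hd : support f ⊆ (chartAt E d).source) :
    ∫ x in (chartAt E c).target, f ((chartAt E c).symm x) * ρ c x ∂μ =
      ∫ x in (chartAt E d).target, f ((chartAt E d).symm x) * ρ d x ∂μ := by
  have key : ∀ a b : M, support f ⊆ (chartAt E b).source →
      ∫ x in (chartAt E a).target, f ((chartAt E a).symm x) * ρ a x ∂μ =
        ∫ x in (transition a b).source, f ((chartAt E a).symm x) * ρ a x ∂μ := by
    intro a b hb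
    refine setIntegral_eq_of_subset_of_forall_sdiff_eq_zero
      (chartAt E a).open_target.measurableSet (fun x hx => (mem_transition_source.1 hx).1) ?_
    intro x hx
    have : f ((chartAt E a).symm x) = 0 := by
      by_contra hne
      exact hx.2 (mem_transition_source.2 ⟨hx.1, hb hne⟩)
    rw [this, zero_mul]
  rw [key c d hd, key d c hc]
  have ht : (transition (E := E) d c).source = (transition c d).target := by
    ext x; simp [transition]
  rw [ht, integral_target_eq_integral_abs_det_fderiv_smul μ
    (fun x hx => hasFDerivAt_transition hx)]
  refine setIntegral_congr_fun (transition c d).open_source.measurableSet fun x hx => ?_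
  have hs := mem_transition_source.1 hx
  simp only [smul_eq_mul]
  rw [h.density_change c d x hx, transition_apply, (chartAt E d).left_inv hs.2]
  ring

theorem DensityField.integrableOn (h : DensityField ρ X) [CompactSpace M] {f : M → ℝ} {c : M}
    (hf : Continuous f) (hc : tsupport f ⊆ (chartAt E c).source) :
    IntegrableOn (fun x => f ((chartAt E c).symm x) * ρ c x) (chartAt E c).target μ := by
  have hK : IsCompact (chartAt E c '' tsupport f) :=
    (isClosed_tsupport f).isCompact.image_of_continuousOn ((chartAt E c).continuousOn.mono hc)
  have hKs : chartAt E c '' tsupport f ⊆ (chartAt E c).target := by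
    rintro _ ⟨q, hq, rfl⟩
    exact (chartAt E c).map_source (hc hq)
  have hcont : ContinuousOn (fun x => f ((chartAt E c).symm x) * ρ c x) (chartAt E c).target :=
    (hf.comp_continuousOn (chartAt E c).continuousOn_symm).mul fun x hx =>
      (h.density_smooth c x hx).continuousAt.continuousWithinAt
  refine ((hcont.mono hKs).integrableOn_compact hK).of_forall_sdiff_eq_zero
    (chartAt E c).open_target.measurableSet ?_
  rintro x ⟨hx, hxK⟩
  have : f ((chartAt E c).symm x) = 0 := by
    by_contra hne
    exact hxK ⟨_, subset_tsupport f hne, (chartAt E c).right_inv hx⟩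
  rw [this, zero_mul]

/-- The divergence theorem for `χ X`, where `χ` is supported in the domain of a chart. -/
theorem DensityField.integral_divergence (h : DensityField ρ X) [CompactSpace M] [T2Space M]
    {δ : M → ℝ}
    (hdiv : ∀ c : M, ∀ x ∈ (chartAt E c).target,
      divergence (fun y => ρ c y • X c y) x = ρ c x * δ ((chartAt E c).symm x))
    {χ : M → ℝ} (hχ : ContMDiff 𝓘(ℝ, E) 𝓘(ℝ, ℝ) ∞ χ) {c : M}
    (hc : tsupport χ ⊆ (chartAt E c).source) :
    IntegrableOn (fun x => χ ((chartAt E c).symm x) * δ ((chartAt E c).symm x) * ρ c x)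
      (chartAt E c).target μ ∧
    ∫ x in (chartAt E c).target, χ ((chartAt E c).symm x) * δ ((chartAt E c).symm x) * ρ c x ∂μ +
      ∫ x in (chartAt E c).target, fieldDeriv X χ ((chartAt E c).symm x) * ρ c x ∂μ = 0 := by
  classical
  set U := (chartAt E c).target with hU
  -- The extension of χ ρ X by zero is C¹ on the whole space, because χ has compact support inside
  -- the chart; this brings the flat divergence theorem into play.
  let F : E → E := U.indicator fun x => χ ((chartAt E c).symm x) • ρ c x • X c x
  have hFx : ∀ x ∈ U, F =ᶠ[𝓝 x] fun x => χ ((chartAt E c).symm x) • ρ c x • X c x := by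
    intro x hx
    filter_upwards [(chartAt E c).open_target.mem_nhds hx] with y hy
    exact indicator_of_mem hy _
  have hK : IsCompact (chartAt E c '' tsupport χ) :=
    (isClosed_tsupport χ).isCompact.image_of_continuousOn ((chartAt E c).continuousOn.mono hc)
  have hKs : chartAt E c '' tsupport χ ⊆ U := by
    rintro _ ⟨q, hq, rfl⟩
    exact (chartAt E c).map_source (hc hq)
  have hF0 : ∀ x ∉ chartAt E c '' tsupport χ, F x = 0 := by
    intro x hx
    by_cases hxU : x ∈ U
    · have : χ ((chartAt E c).symm x) = 0 := by
        by_contra hne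
        exact hx ⟨_, subset_tsupport χ hne, (chartAt E c).right_inv hxU⟩
      rw [(hFx x hxU).self_of_nhds]
      simp only [this, zero_smul]
    · exact indicator_of_notMem hxU _
  have hFc : HasCompactSupport F := HasCompactSupport.intro hK hF0
  have hFt : tsupport F ⊆ chartAt E c '' tsupport χ :=
    closure_minimal (fun x hx => by_contra fun hn => hx (hF0 x hn)) hK.isClosed
  have hχx : ∀ x ∈ U, ContDiffAt ℝ 1 (fun y => χ ((chartAt E c).symm y)) x := fun x hx =>
    (contDiffAt_comp_chart_symm hχ hx).of_le (by simp)
  have hFs : ContDiff ℝ 1 F := by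
    rw [contDiff_iff_contDiffAt]
    intro x
    by_cases hx : x ∈ tsupport F
    · have hxU := hKs (hFt hx)
      exact ContDiffAt.congr_of_eventuallyEq ((hχx x hxU).smul
        ((h.density_smooth c x hxU).smul (h.field_smooth c x hxU))) (hFx x hxU)
    · exact contDiffAt_const.congr_of_eventuallyEq (notMem_tsupport_iff_eventuallyEq.1 hx)
  have hdF : ∀ x ∈ U, divergence F x =
      χ ((chartAt E c).symm x) * δ ((chartAt E c).symm x) * ρ c x
        + fieldDeriv X χ ((chartAt E c).symm x) * ρ c x := by
    intro x hx
    have hd : DifferentiableAt ℝ (fun y => ρ c y • X c y) x :=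
      ((h.density_smooth c x hx).smul (h.field_smooth c x hx)).differentiableAt one_ne_zero
    rw [divergence, (hFx x hx).fderiv_eq, ← divergence,
      divergence_smul ((hχx x hx).differentiableAt one_ne_zero) hd,
      hdiv c x hx, h.fieldDeriv_eq hχ hx]
    simp only [map_smul, smul_eq_mul]
    ring
  have hi1 : IntegrableOn (fun x => fieldDeriv X χ ((chartAt E c).symm x) * ρ c x) U μ :=
    h.integrableOn μ (h.continuous_fieldDeriv hχ)
      ((closure_minimal (support_fieldDeriv_subset χ) (isClosed_tsupport χ)).trans hc)
  have hi2 : IntegrableOn (divergence F) U μ :=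
    ((continuous_divergence hFs).integrable_of_hasCompactSupport
      (hFc.mono' (support_divergence_subset F))).integrableOn
  have hi3 : IntegrableOn
      (fun x => χ ((chartAt E c).symm x) * δ ((chartAt E c).symm x) * ρ c x) U μ := by
    refine (hi2.sub hi1).congr_fun (fun x hx => ?_) (chartAt E c).open_target.measurableSet
    simp [hdF x hx]
  refine ⟨hi3, ?_⟩
  rw [← integral_add hi3 hi1, ← integral_divergence_eq_zero μ hFs hFc,
    ← setIntegral_eq_integral_of_forall_compl_eq_zero (s := U) (f := divergence F)]
  · exact setIntegral_congr_fun (chartAt E c).open_target.measurableSet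
      fun x hx => (hdF x hx).symm
  · intro x hx
    by_contra hne
    exact hx (hKs (hFt (support_divergence_subset F hne)))

end GlobalDivergence

/-! ### Globalization by a partition of unity. -/

section NoPositiveDivergence

variable {E : Type*} [NormedAddCommGroup E] [NormedSpace ℝ E] [FiniteDimensional ℝ E]
  {M : Type*} [TopologicalSpace M] [ChartedSpace E M] [IsManifold 𝓘(ℝ, E) ∞ M]
  {ρ : M → E → ℝ} {X : M → E → E}

/-- On a nonempty compact manifold no vector field has positive divergence with respect to a
positive density. -/
theorem DensityField.false_of_divergence_pos (h : DensityField ρ X) [CompactSpace M] [T2Space M]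
    [Nonempty M] {δ : M → ℝ} (hδ : ∀ q, 0 < δ q)
    (hdiv : ∀ c : M, ∀ x ∈ (chartAt E c).target,
      divergence (fun y => ρ c y • X c y) x = ρ c x * δ ((chartAt E c).symm x)) : False := by
  classical
  borelize E
  let μ : Measure E := Measure.addHaar
  obtain ⟨t, ht⟩ := isCompact_univ.elim_finite_subcover
    (fun c : M => (chartAt E c).source) (fun c => (chartAt E c).open_source)
    (fun q _ => mem_iUnion.2 ⟨q, mem_chart_source E q⟩)
  obtain ⟨χ, hχ⟩ := SmoothPartitionOfUnity.exists_isSubordinate 𝓘(ℝ, E) isClosed_univ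
    (fun c : t => (chartAt E (c : M)).source) (fun c => (chartAt E (c : M)).open_source)
    (by simpa [iUnion_subtype] using ht)
  have hsum : ∀ q, ∑ i, χ i q = 1 := fun q => by
    rw [← finsum_eq_sum_of_fintype]; exact χ.sum_eq_one (mem_univ q)
  have hsm : ∀ i, ContMDiff 𝓘(ℝ, E) 𝓘(ℝ, ℝ) ∞ (χ i) := fun i => (χ i).contMDiff
  have hdsum : ∀ q, ∑ i, fieldDeriv X (χ i) q = 0 := by
    intro q
    simp only [fieldDeriv]
    rw [← sum_apply, ← fderiv_fun_sum fun i _ =>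
      (contDiffAt_comp_chart_symm (hsm i) (mem_chart_target E q)).differentiableAt (by simp)]
    have : (fun y => ∑ i, χ i ((chartAt E q).symm y)) = fun _ => 1 := funext fun y => hsum _
    simp only [this, fderiv_fun_const, Pi.zero_apply, zero_apply]
  let J : M → (M → ℝ) → ℝ := fun c f =>
    ∫ x in (chartAt E c).target, f ((chartAt E c).symm x) * ρ c x ∂μ
  have hts : ∀ i, tsupport (fieldDeriv X (χ i)) ⊆ (chartAt E (i : M)).source := fun i =>
    (closure_minimal (support_fieldDeriv_subset (χ i)) (isClosed_tsupport _)).trans (hχ i)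
  have hcts : ∀ i j, Continuous fun q => χ j q * fieldDeriv X (χ i) q := fun i j =>
    (hsm j).continuous.mul (h.continuous_fieldDeriv (hsm i))
  -- Insert 1 = ∑ χ_j into the i-th integral, move each term χ_j · Xχ_i from chart i to chart j (it
  -- is supported in both), and interchange the sums: in chart j the integrand contains ∑ Xχ_i =
  -- X(1) = 0.
  have hJ0 : ∑ i : t, J i (fieldDeriv X (χ i)) = 0 := by
    have h1 : ∀ i : t, J i (fieldDeriv X (χ i))
        = ∑ j : t, J i (fun q => χ j q * fieldDeriv X (χ i) q) := by
      intro i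
      simp only [J]
      rw [← integral_finsetSum]
      · refine setIntegral_congr_fun (chartAt E (i : M)).open_target.measurableSet fun x _ => ?_
        simp only [← Finset.sum_mul, hsum, one_mul]
      · exact fun j _ => h.integrableOn μ (hcts i j)
          ((tsupport_mul_subset_right).trans (hts i))
    have h2 : ∀ i j : t, J i (fun q => χ j q * fieldDeriv X (χ i) q)
        = J j (fun q => χ j q * fieldDeriv X (χ i) q) := by
      intro i j
      refine h.setIntegral_eq μ (f := fun q => χ j q * fieldDeriv X (χ i) q) ?_ ?_
      · exact (subset_tsupport _).trans ((tsupport_mul_subset_right).trans (hts i))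
      · exact (subset_tsupport _).trans ((tsupport_mul_subset_left).trans (hχ j))
    rw [Finset.sum_congr rfl fun i _ => (h1 i).trans (Finset.sum_congr rfl fun j _ => h2 i j),
      Finset.sum_comm]
    refine Finset.sum_eq_zero fun j _ => ?_
    rw [← integral_finsetSum]
    · have : ∀ x, ∑ i : t, χ j ((chartAt E (j : M)).symm x)
          * fieldDeriv X (χ i) ((chartAt E (j : M)).symm x) * ρ j x = 0 := by
        intro x
        rw [← Finset.sum_mul, ← Finset.mul_sum, hdsum, mul_zero, zero_mul]
      exact (integral_congr_ae (Filter.Eventually.of_forall this)).trans (integral_zero _ _)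
    · exact fun i _ => h.integrableOn μ (hcts i j) ((tsupport_mul_subset_left).trans (hχ j))
  have hD := fun i : t => h.integral_divergence μ hdiv (hsm i) (hχ i)
  have hnn : ∀ i : t, ∀ x ∈ (chartAt E (i : M)).target, 0 ≤ χ i ((chartAt E (i : M)).symm x)
      * δ ((chartAt E (i : M)).symm x) * ρ i x := fun i x hx =>
    mul_nonneg (mul_nonneg (χ.nonneg i _) (hδ _).le) (h.pos (i : M) x hx).le
  have hI0 : ∑ i : t, J i (fun q => χ i q * δ q) = 0 := by
    have : ∑ i : t, (J i (fun q => χ i q * δ q) + J i (fieldDeriv X (χ i))) = 0 :=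
      Finset.sum_eq_zero fun i _ => (hD i).2
    rwa [Finset.sum_add_distrib, hJ0, add_zero] at this
  obtain ⟨q⟩ := ‹Nonempty M›
  obtain ⟨i, hi⟩ : ∃ i : t, 0 < χ i q := by
    by_contra hcon
    push Not at hcon
    have := hsum q
    rw [Finset.sum_eq_zero fun i _ => le_antisymm (hcon i) (χ.nonneg i q)] at this
    exact zero_ne_one this
  have hIi : J i (fun q => χ i q * δ q) = 0 :=
    (Finset.sum_eq_zero_iff_of_nonneg fun (i : t) _ =>
      setIntegral_nonneg (chartAt E (i : M)).open_target.measurableSet (hnn i)).1 hI0 i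
      (Finset.mem_univ i)
  have hqs : q ∈ (chartAt E (i : M)).source := hχ i (subset_tsupport _ hi.ne')
  -- The i-th integrand is nonnegative, and positive on the nonempty open set where χ_i > 0.
  refine absurd hIi (ne_of_gt ?_)
  refine (setIntegral_pos_iff_support_of_nonneg_ae ?_ (hD i).1).2 ?_
  · exact (ae_restrict_iff' (chartAt E (i : M)).open_target.measurableSet).2
      (Filter.Eventually.of_forall fun x hx => hnn i x hx)
  · have hopen : IsOpen ((chartAt E (i : M)).target ∩ (chartAt E (i : M)).symm ⁻¹' {p | 0 < χ i p}) :=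
      (chartAt E (i : M)).isOpen_inter_preimage_symm
        (isOpen_lt continuous_const (hsm i).continuous)
    refine (hopen.measure_pos μ ⟨chartAt E (i : M) q, (chartAt E (i : M)).map_source hqs, ?_⟩).trans_le
      (measure_mono ?_)
    · simpa [(chartAt E (i : M)).left_inv hqs] using hi
    · rintro x ⟨hx, hx'⟩
      exact ⟨(mul_pos (mul_pos hx' (hδ _)) (h.pos (i : M) x hx)).ne', hx⟩

end NoPositiveDivergence

end LeviCR

namespace LeviCR

open Set Function

/-! ### Exterior derivatives, Gram determinants and the divergence of the Liouville field in
coordinates. -/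

section LocalCalculus

variable {E : Type*} [NormedAddCommGroup E] [NormedSpace ℝ E]

/-- The exterior derivative of a 1-form on a vector space. -/
noncomputable def extd (β : E → E →L[ℝ] ℝ) (x : E) : E →L[ℝ] E →L[ℝ] ℝ :=
  fderiv ℝ β x - (fderiv ℝ β x).flip

theorem extd_apply (β : E → E →L[ℝ] ℝ) (x v w : E) :
    extd β x v w = fderiv ℝ β x v w - fderiv ℝ β x w v := rfl

theorem extd_swap (β : E → E →L[ℝ] ℝ) (x v w : E) : extd β x v w = -extd β x w v := by
  simp [extd_apply]

theorem extd_self (β : E → E →L[ℝ] ℝ) (x v : E) : extd β x v v = 0 := by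
  simp [extd_apply]

theorem two_le_infty : minSmoothness ℝ 2 ≤ (∞ : WithTop ℕ∞) := by
  simpa using (mod_cast le_top : ((2 : ℕ∞) : WithTop ℕ∞) ≤ ∞)

theorem contDiffAt_extd {β : E → E →L[ℝ] ℝ} {x : E} (hβ : ContDiffAt ℝ ∞ β x) :
    ContDiffAt ℝ ∞ (extd β) x := by
  have h := hβ.fderiv_right (m := ∞) le_rfl
  exact h.sub ((ContinuousLinearMap.flipₗᵢ ℝ E E ℝ).contDiff.contDiffAt.comp x h)

/-- The exterior derivative commutes with pullbacks. -/
theorem extd_pullback {β γ : E → E →L[ℝ] ℝ} {t : E → E} {x : E} (ht : ContDiffAt ℝ ∞ t x)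
    (hγ : DifferentiableAt ℝ γ (t x))
    (h : β =ᶠ[𝓝 x] fun y => (γ (t y)).comp (fderiv ℝ t y)) (v w : E) :
    extd β x v w = extd γ (t x) (fderiv ℝ t x v) (fderiv ℝ t x w) := by
  have h2 : DifferentiableAt ℝ (fderiv ℝ t) x :=
    (ht.fderiv_right (m := ∞) le_rfl).differentiableAt (by simp)
  have h1 : HasFDerivAt (fun y => γ (t y)) ((fderiv ℝ γ (t x)).comp (fderiv ℝ t x)) x :=
    hγ.hasFDerivAt.comp x (ht.differentiableAt (by simp)).hasFDerivAt
  -- The terms containing the second derivative of t are symmetric in v and w and cancel after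
  -- skew-symmetrization.
  have hsymm : IsSymmSndFDerivAt ℝ t x := ht.isSymmSndFDerivAt two_le_infty
  have hd := h.fderiv_eq.trans (h1.clm_comp h2.hasFDerivAt).fderiv
  simp only [extd_apply, hd]
  simp [hsymm.eq v w]

/-- The exterior derivative of an exterior derivative vanishes. -/
theorem fderiv_extd {β : E → E →L[ℝ] ℝ} {x : E} (hβ : ContDiffAt ℝ ∞ β x) (u v w : E) :
    fderiv ℝ (extd β) x u v w = fderiv ℝ (extd β) x v u w - fderiv ℝ (extd β) x w u v := by
  have h2 : DifferentiableAt ℝ (fderiv ℝ β) x :=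
    (hβ.fderiv_right (m := ∞) le_rfl).differentiableAt (by simp)
  have hsymm : IsSymmSndFDerivAt ℝ β x := hβ.isSymmSndFDerivAt two_le_infty
  have hd : HasFDerivAt (extd β) (fderiv ℝ (fderiv ℝ β) x -
      ((ContinuousLinearMap.flipₗᵢ ℝ E E ℝ).toContinuousLinearEquiv :
        (E →L[ℝ] E →L[ℝ] ℝ) →L[ℝ] (E →L[ℝ] E →L[ℝ] ℝ)).comp (fderiv ℝ (fderiv ℝ β) x)) x :=
    h2.hasFDerivAt.sub ((ContinuousLinearMap.flipₗᵢ ℝ E E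
      ℝ).toContinuousLinearEquiv.hasFDerivAt.comp x h2.hasFDerivAt)
  have hap : ∀ a b c, fderiv ℝ (extd β) x a b c =
      fderiv ℝ (fderiv ℝ β) x a b c - fderiv ℝ (fderiv ℝ β) x a c b := by
    intro a b c
    rw [hd.fderiv]
    rfl
  rw [hap, hap, hap, hsymm.eq u v, hsymm.eq u w, hsymm.eq v w]
  ring

/-- The bilinear form `dθ + h ⊗ h`. -/
noncomputable def metricForm (h θ : E → E →L[ℝ] ℝ) (x : E) : E →L[ℝ] E →L[ℝ] ℝ :=
  extd θ x + (h x).smulRight (h x)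

theorem metricForm_apply (h θ : E → E →L[ℝ] ℝ) (x v w : E) :
    metricForm h θ x v w = extd θ x v w + h x v * h x w := rfl

theorem contDiffAt_metricForm {h θ : E → E →L[ℝ] ℝ} {x : E} (hh : ContDiffAt ℝ ∞ h x)
    (hθ : ContDiffAt ℝ ∞ θ x) : ContDiffAt ℝ ∞ (metricForm h θ) x :=
  (contDiffAt_extd hθ).add (hh.smulRight hh)

variable {ι : Type*} [Fintype ι] [DecidableEq ι] (b : Module.Basis ι ℝ E)

/-- The Gram matrix of a bilinear form. -/
noncomputable def gram (G : E →L[ℝ] E →L[ℝ] ℝ) : Matrix ι ι ℝ := Matrix.of fun i j => G (b i) (b j)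

theorem contDiff_det_gram : ContDiff ℝ ∞ fun G : E →L[ℝ] E →L[ℝ] ℝ => (gram b G).det := by
  simp only [Matrix.det_apply', gram, Matrix.of_apply]
  fun_prop

/-- Jacobi's formula: along the line G + tK the determinant is det G · det(1 + tN) with N = G⁻¹K,
and the linear coefficient of det(1 + tN) is tr N. -/
theorem fderiv_det_gram {G : E →L[ℝ] E →L[ℝ] ℝ} (hG : (gram b G).det ≠ 0)
    (K : E →L[ℝ] E →L[ℝ] ℝ) :
    fderiv ℝ (fun G : E →L[ℝ] E →L[ℝ] ℝ => (gram b G).det) G K =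
      (gram b G).det * ((gram b G)⁻¹ * gram b K).trace := by
  set N := (gram b G)⁻¹ * gram b K with hN
  have hK : gram b K = gram b G * N := by
    rw [hN, Matrix.mul_nonsing_inv_cancel_left _ _ (isUnit_iff_ne_zero.2 hG)]
  have hline : ∀ t : ℝ, (gram b (G + t • K)).det = (gram b G).det * (1 + t • N).det := by
    intro t
    rw [← Matrix.det_mul, mul_add, mul_one, Matrix.mul_smul, ← hK]
    rfl
  obtain ⟨q, hq⟩ : ∃ q : Polynomial ℝ, ∀ t : ℝ,
      (1 + t • N).det = 1 + N.trace * t + q.eval t * t ^ 2 :=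
    ⟨_, fun t => Matrix.det_one_add_smul t N⟩
  have h1 : HasDerivAt (fun t : ℝ => (gram b (G + t • K)).det)
      ((gram b G).det * N.trace) 0 := by
    simp_rw [hline, hq]
    have := ((((hasDerivAt_id (0 : ℝ)).const_mul N.trace).const_add 1).add
      ((q.hasDerivAt (0 : ℝ)).mul (hasDerivAt_pow 2 (0 : ℝ)))).const_mul (gram b G).det
    exact this.congr_deriv (by simp)
  have h3 := (((contDiff_det_gram b).differentiable (by simp)) G).hasFDerivAt.hasLineDerivAt K
  exact h3.unique h1

/-- Composing in the first slot multiplies by the transpose on the left, composing in the second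
slot by the matrix itself on the right. -/
theorem gram_comp (G : E →L[ℝ] E →L[ℝ] ℝ) (A : E →L[ℝ] E) (i j : ι) :
    gram b (G.comp A) i j = ((LinearMap.toMatrix b b (A : E →ₗ[ℝ] E)).transpose * gram b G) i j ∧
    gram b ((G.flip.comp A).flip) i j = (gram b G * LinearMap.toMatrix b b (A : E →ₗ[ℝ] E)) i j := by
  have hA : ∀ k, A (b k) = ∑ l, LinearMap.toMatrix b b (A : E →ₗ[ℝ] E) l k • b l := by
    intro k
    conv_lhs => rw [← b.sum_repr (A (b k))]
    simp [LinearMap.toMatrix_apply]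
  constructor
  · simp [gram, Matrix.mul_apply, hA i]
  · simp [gram, Matrix.mul_apply, hA j, mul_comm]

/-- The density of a bilinear form. -/
noncomputable def gramDensity (G : E →L[ℝ] E →L[ℝ] ℝ) : ℝ := √|(gram b G).det|

theorem gramDensity_pos {G : E →L[ℝ] E →L[ℝ] ℝ} (hG : (gram b G).det ≠ 0) :
    0 < gramDensity b G := Real.sqrt_pos.2 (abs_pos.2 hG)

theorem contDiffAt_gramDensity {G : E →L[ℝ] E →L[ℝ] ℝ} (hG : (gram b G).det ≠ 0) :
    ContDiffAt ℝ ∞ (gramDensity b) G :=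
  (((contDiff_det_gram b).contDiffAt).abs hG).sqrt (abs_ne_zero.2 hG)

/-- The square root halves the logarithmic derivative of the determinant; the absolute value does
not affect it. -/
theorem fderiv_gramDensity {G : E →L[ℝ] E →L[ℝ] ℝ} (hG : (gram b G).det ≠ 0)
    (K : E →L[ℝ] E →L[ℝ] ℝ) :
    fderiv ℝ (gramDensity b) G K =
      gramDensity b G * (((gram b G)⁻¹ * gram b K).trace / 2) := by
  have h1 := (((contDiff_det_gram b).differentiable (by simp)) G).hasFDerivAt
  have h0 : HasFDerivAt (fun G : E →L[ℝ] E →L[ℝ] ℝ => |(gram b G).det|) _ G :=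
    HasDerivAt.comp_hasFDerivAt (h₂ := fun r : ℝ => |r|) G (hasDerivAt_abs hG) h1
  have h2 := h0.sqrt (abs_ne_zero.2 hG)
  have h3 : fderiv ℝ (gramDensity b) G = _ := h2.fderiv
  rw [h3]
  simp only [smul_apply, smul_eq_mul]
  rw [fderiv_det_gram b hG]
  change 1 / (2 * gramDensity b G) * _ = _
  have hs : gramDensity b G ^ 2 = |(gram b G).det| := Real.sq_sqrt (abs_nonneg _)
  have hpos := gramDensity_pos b hG
  have ha : (SignType.sign (gram b G).det : ℝ) * (gram b G).det = gramDensity b G ^ 2 := by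
    rw [hs, sign_mul_self]
  field_simp
  linear_combination ((gram b G)⁻¹ * gram b K).trace * ha

/-- The matrix of the pullback is AᵀGA, so its determinant gains the factor (det A)², whose root is
|det A|. This is the transformation law of a density. -/
theorem gramDensity_pullback (G : E →L[ℝ] E →L[ℝ] ℝ) (A : E →L[ℝ] E)
    {G' : E →L[ℝ] E →L[ℝ] ℝ} (h : ∀ v w, G' v w = G (A v) (A w)) :
    gramDensity b G' = |A.det| * gramDensity b G := by
  have hG' : G' = ((G.comp A).flip.comp A).flip := by
    ext v w; simp [h]
  have hm : gram b G' = (LinearMap.toMatrix b b (A : E →ₗ[ℝ] E)).transpose * gram b G *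
      LinearMap.toMatrix b b (A : E →ₗ[ℝ] E) := by
    rw [hG']
    have h1 : gram b (G.comp A) = (LinearMap.toMatrix b b (A : E →ₗ[ℝ] E)).transpose * gram b G :=
      Matrix.ext fun i j => (gram_comp b G A i j).1
    rw [← h1]
    exact Matrix.ext fun i j => (gram_comp b (G.comp A) A i j).2
  have hd : (gram b G').det = A.det ^ 2 * (gram b G).det := by
    rw [hm, Matrix.det_mul, Matrix.det_mul, Matrix.det_transpose, LinearMap.det_toMatrix]
    change A.det * _ * A.det = _
    ring
  rw [gramDensity, gramDensity, hd, abs_mul, Real.sqrt_mul (abs_nonneg _), abs_pow,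
    Real.sqrt_sq (abs_nonneg _)]

/-- The divergence of a field `X` in `ker h` with `dθ (X, ·) = θ + f h`, with respect to the
density of `dθ + h ⊗ h`. -/
theorem divergence_gramDensity_smul [FiniteDimensional ℝ E] {h θ : E → E →L[ℝ] ℝ} {X : E → E}
    {f : E → ℝ} {x R : E}
    {κ : E →L[ℝ] ℝ} {lam : ℝ} (hh : ContDiffAt ℝ ∞ h x) (hθ : ContDiffAt ℝ ∞ θ x)
    (hX : DifferentiableAt ℝ X x) (hf : DifferentiableAt ℝ f x)
    (hdet : (gram b (metricForm h θ x)).det ≠ 0)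
    (hXθ : ∀ᶠ y in 𝓝 x, ∀ v, extd θ y (X y) v = θ y v + f y * h y v)
    (hXh : ∀ᶠ y in 𝓝 x, h y (X y) = 0)
    (hlam : ∀ v, extd h x (X x) v = lam * h x v)
    (hκ : ∀ v w, extd h x v w = κ v * h x w - κ w * h x v)
    (hR : ∀ v, extd θ x R v = 0) (hR1 : h x R = 1) :
    divergence (fun y => gramDensity b (metricForm h θ y) • X y) x =
      gramDensity b (metricForm h θ x) * (((Fintype.card ι : ℝ) - 1) / 2 + lam) := by
  set G := metricForm h θ x with hG
  set D := fderiv ℝ X x with hD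
  have hGs := contDiffAt_metricForm hh hθ
  have hGd := hGs.differentiableAt (by simp)
  have hhd := hh.differentiableAt (by simp)
  have hθd := hθ.differentiableAt (by simp)
  have hed := (contDiffAt_extd hθ).differentiableAt (by simp)
  set K := fderiv ℝ (metricForm h θ) x (X x) with hK
  have hKap : ∀ v w, K v w = fderiv ℝ (extd θ) x (X x) v w
      + (fderiv ℝ h x (X x) v * h x w + h x v * fderiv ℝ h x (X x) w) := by
    intro v w
    have h1 : HasFDerivAt (fun y => metricForm h θ y v w) _ x :=
      (hGd.hasFDerivAt.clm_apply (hasFDerivAt_const v x)).clm_apply (hasFDerivAt_const w x)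
    have h2 : HasFDerivAt (fun y => extd θ y v w) _ x :=
      (hed.hasFDerivAt.clm_apply (hasFDerivAt_const v x)).clm_apply (hasFDerivAt_const w x)
    have h3 : ∀ u, HasFDerivAt (fun y => h y u)
        ((ContinuousLinearMap.apply ℝ ℝ u).comp (fderiv ℝ h x)) x := fun u =>
      (ContinuousLinearMap.apply ℝ ℝ u).hasFDerivAt.comp x hhd.hasFDerivAt
    have h4 := congrArg (fun A => A (X x)) (h1.unique (h2.add ((h3 v).mul (h3 w))))
    simp at h4
    rw [hK, h4]
    ring
  -- The next two facts differentiate the defining equations dθ(X, ·) = θ + f h and h(X) = 0, which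
  -- hold near x.
  have hder1 : ∀ v w, fderiv ℝ (extd θ) x v (X x) w + extd θ x (D v) w =
      fderiv ℝ θ x v w + (fderiv ℝ f x v * h x w + f x * fderiv ℝ h x v w) := by
    intro v w
    have h1 : HasFDerivAt (fun y => extd θ y (X y) w) _ x :=
      (ContinuousLinearMap.apply ℝ ℝ w).hasFDerivAt.comp x (hed.hasFDerivAt.clm_apply
        hX.hasFDerivAt)
    have h3 : ∀ {β : E → E →L[ℝ] ℝ}, DifferentiableAt ℝ β x → HasFDerivAt (fun y => β y w)
        ((ContinuousLinearMap.apply ℝ ℝ w).comp (fderiv ℝ β x)) x := fun hβ =>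
      (ContinuousLinearMap.apply ℝ ℝ w).hasFDerivAt.comp x hβ.hasFDerivAt
    have h2 := (h3 hθd).add (hf.hasFDerivAt.mul (h3 hhd))
    have h4 := congrArg (fun A => A v) (h1.unique
      (h2.congr_of_eventuallyEq (hXθ.mono fun y hy => hy w)))
    simp at h4
    rw [hD]
    linear_combination h4
  have hder2 : ∀ v, fderiv ℝ h x v (X x) + h x (D v) = 0 := by
    intro v
    have h1 := (hhd.hasFDerivAt.clm_apply hX.hasFDerivAt).unique
      ((hasFDerivAt_const (0 : ℝ) x).congr_of_eventuallyEq hXh)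
    have h4 := congrArg (fun A => A v) h1
    simp at h4
    rw [hD]
    linear_combination h4
  -- Since dh = κ ∧ h, the exterior derivative of θ + f h is dθ + k ∧ h for this k.
  let k : E →L[ℝ] ℝ := fderiv ℝ f x + f x • κ
  -- Cartan's formula in coordinates: L_X dθ = d(θ + f h) = dθ + k ∧ h and L_X h = λ h, so L_X G = G
  -- + (2λ - 1) h ⊗ h + k ∧ h. The terms in D are the difference between L_X G and the derivative K
  -- of the coefficients.
  have hL : ∀ v w, K v w = G v w + (2 * lam - 1) * (h x v * h x w)
      + (k v * h x w - h x v * k w) - G (D v) w - G v (D w) := by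
    intro v w
    have e1 := fderiv_extd hθ (X x) v w
    have e2 := hder1 v w
    have e3 := hder1 w v
    have e4 := hder2 v
    have e5 := hder2 w
    have e6 := hlam v
    have e7 := hlam w
    have e8 := hκ v w
    have e9 := extd_swap θ x (D w) v
    rw [extd_apply] at e6 e7 e8
    simp only [hKap, hG, metricForm_apply, k, add_apply, smul_apply, smul_eq_mul]
    rw [extd_apply θ x v w]
    linear_combination e1 + e2 - e3 + h x w * (e6 + e4) + h x v * (e7 + e5) + f x * e8 + e9
  set m := gram b G with hm
  set C := LinearMap.toMatrix b b (D : E →ₗ[ℝ] E) with hC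
  let hv : ι → ℝ := fun i => h x (b i)
  let kv : ι → ℝ := fun i => k (b i)
  have hmat : gram b K = m + (2 * lam - 1) • Matrix.vecMulVec hv hv
      + (Matrix.vecMulVec kv hv - Matrix.vecMulVec hv kv) - C.transpose * m - m * C := by
    ext i j
    have h1 := (gram_comp b G D i j).1
    have h2 := (gram_comp b G D i j).2
    simp only [Matrix.sub_apply, Matrix.add_apply, Matrix.smul_apply, Matrix.vecMulVec_apply]
    rw [← h1, ← h2]
    exact hL (b i) (b j)
  let r : ι → ℝ := fun i => b.repr R i
  have hsum : ∀ l : E →L[ℝ] ℝ, ∑ i, r i * l (b i) = l R := by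
    intro l
    conv_rhs => rw [← b.sum_repr R]
    simp only [map_sum, map_smul, smul_eq_mul]
    rfl
  have hunit : IsUnit m.det := isUnit_iff_ne_zero.2 hdet
  -- Although G is not symmetric, R represents h through either slot. So m⁻¹ sends h to R from both
  -- sides, as the traces below require.
  have hGR : ∀ v, G R v = h x v := fun v => by rw [hG, metricForm_apply, hR, hR1]; ring
  have hGR' : ∀ v, G v R = h x v := fun v => by
    rw [hG, metricForm_apply, extd_swap, hR, hR1]; ring
  have hmr : Matrix.mulVec m r = hv := by
    ext i
    have := hsum (G (b i))
    rw [hGR'] at this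
    simp only [Matrix.mulVec, dotProduct, hv, ← this, hm, gram, Matrix.of_apply]
    exact Finset.sum_congr rfl fun j _ => mul_comm _ _
  have hrm : Matrix.vecMul r m = hv := by
    ext j
    have := hsum (G.flip (b j))
    rw [G.flip_apply, hGR] at this
    simp only [Matrix.vecMul, dotProduct, hv, ← this, hm, gram, Matrix.of_apply]
    rfl
  have hinv1 : Matrix.mulVec m⁻¹ hv = r := by
    rw [← hmr, Matrix.mulVec_mulVec, Matrix.nonsing_inv_mul _ hunit, Matrix.one_mulVec]
  have hinv2 : Matrix.vecMul hv m⁻¹ = r := by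
    rw [← hrm, Matrix.vecMul_vecMul, Matrix.mul_nonsing_inv _ hunit, Matrix.vecMul_one]
  have hrh : r ⬝ᵥ hv = 1 := by rw [← hR1]; exact hsum (h x)
  -- The term h ⊗ h contributes h(R) = 1, the two halves of k ∧ h both give k(R) and cancel, and
  -- each of the last two terms contributes -tr C. The latter cancel against div X in the final
  -- formula.
  have htr : (m⁻¹ * gram b K).trace = (Fintype.card ι : ℝ) - 1 + 2 * lam - 2 * C.trace := by
    rw [hmat]
    simp only [mul_add, mul_sub, Matrix.mul_smul, Matrix.trace_add, Matrix.trace_sub,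
      Matrix.trace_smul, Matrix.nonsing_inv_mul _ hunit, Matrix.trace_one,
      Matrix.nonsing_inv_mul_cancel_left _ _ hunit, Matrix.mul_vecMulVec, Matrix.trace_vecMulVec,
      hinv1, hrh]
    rw [← Matrix.mul_assoc, Matrix.trace_mul_comm (m⁻¹ * C.transpose) m, ← Matrix.mul_assoc,
      Matrix.mul_nonsing_inv _ hunit, one_mul, Matrix.trace_transpose,
      dotProduct_comm (Matrix.mulVec m⁻¹ kv) hv, Matrix.dotProduct_mulVec, hinv2]
    simp only [smul_eq_mul]
    ring
  have hρd : DifferentiableAt ℝ (fun y => gramDensity b (metricForm h θ y)) x :=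
    DifferentiableAt.comp x (g := gramDensity b)
      ((contDiffAt_gramDensity b hdet).differentiableAt (by simp)) hGd
  rw [divergence_smul hρd hX]
  have hcomp : fderiv ℝ (fun y => gramDensity b (metricForm h θ y)) x (X x)
      = fderiv ℝ (gramDensity b) G K := by
    have := fderiv_comp x ((contDiffAt_gramDensity b hdet).differentiableAt (by simp)) hGd
    exact congrArg (fun A => A (X x)) this
  have hdivX : divergence X x = C.trace := by
    rw [divergence, LinearMap.trace_eq_matrix_trace ℝ b]
  rw [hcomp, fderiv_gramDensity b hdet, htr, hdivX]
  ring

end LocalCalculus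

/-! ### Skew forms nondegenerate on a hyperplane. -/

section SkewForms

variable {E : Type*} [NormedAddCommGroup E] [NormedSpace ℝ E] [FiniteDimensional ℝ E]

/-- A skew bilinear form `B` which is nondegenerate on the hyperplane `ker a`. -/
structure NondegenerateOnKer (a : E →L[ℝ] ℝ) (B : E →L[ℝ] E →L[ℝ] ℝ) : Prop where
  ne_zero : a ≠ 0
  skew : ∀ v w, B v w = -B w v
  nondegenerate : ∀ v, a v = 0 → (∀ w, a w = 0 → B v w = 0) → v = 0

variable {a : E →L[ℝ] ℝ} {B : E →L[ℝ] E →L[ℝ] ℝ}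
  {ι : Type*} [Fintype ι] [DecidableEq ι] (b : Module.Basis ι ℝ E)

theorem exists_ne_zero_of_det_gram_eq_zero {G : E →L[ℝ] E →L[ℝ] ℝ} (hG : (gram b G).det = 0) :
    ∃ v ≠ 0, ∀ w, G v w = 0 := by
  obtain ⟨r, hr, hrG⟩ := Matrix.exists_vecMul_eq_zero_iff.2 hG
  refine ⟨∑ i, r i • b i, ?_, ?_⟩
  · intro h0
    apply hr
    ext i
    have := congrArg (fun v => b.repr v i) h0
    simpa [Finsupp.single_apply] using this
  · have hb : ∀ j, G (∑ i, r i • b i) (b j) = 0 := by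
      intro j
      have := congrFun hrG j
      simpa [Matrix.vecMul, dotProduct, gram] using this
    intro w
    rw [← b.sum_repr w, map_sum]
    exact Finset.sum_eq_zero fun j _ => by rw [map_smul, hb, smul_zero]

/-- On an odd-dimensional space there is a vector in the kernel of `B` transverse to `ker a`. -/
theorem NondegenerateOnKer.exists_reeb (H : NondegenerateOnKer a B)
    (hodd : Odd (Module.finrank ℝ E)) : ∃ R, a R = 1 ∧ ∀ v, B R v = 0 := by
  classical
  let b := Module.finBasis ℝ E
  -- A skew-symmetric matrix of odd size is singular.
  have hdet : (gram b B).det = 0 := by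
    have ht : (gram b B).transpose = -gram b B := by
      ext i j
      exact H.skew _ _
    have := Matrix.det_transpose (gram b B)
    rw [ht, Matrix.det_neg, Fintype.card_fin, hodd.neg_one_pow] at this
    linarith
  obtain ⟨v, hv0, hv⟩ := exists_ne_zero_of_det_gram_eq_zero b hdet
  have hav : a v ≠ 0 := fun h => hv0 (H.nondegenerate v h fun w _ => hv w)
  refine ⟨(a v)⁻¹ • v, ?_, ?_⟩
  · rw [map_smul, smul_eq_mul, inv_mul_cancel₀ hav]
  · intro w
    rw [map_smul, smul_apply, hv, smul_zero]

/-- Nondegeneracy of B + a ⊗ a. Testing against the Reeb vector gives a(v) = 0; then B(v, ·) = 0,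
and nondegeneracy on ker a applies. -/
theorem NondegenerateOnKer.eq_zero (H : NondegenerateOnKer a B)
    (hodd : Odd (Module.finrank ℝ E)) {v : E} (hv : ∀ w, B v w + a v * a w = 0) : v = 0 := by
  obtain ⟨R, hR1, hR⟩ := H.exists_reeb hodd
  have hav : a v = 0 := by
    have := hv R
    rwa [H.skew, hR, hR1, mul_one, neg_zero, zero_add] at this
  refine H.nondegenerate v hav fun w _ => ?_
  simpa [hav] using hv w

end SkewForms

/-! ### Reeb and Liouville fields by inversion of G = dθ + h ⊗ h. -/

section LiouvilleField

variable {E : Type*} [NormedAddCommGroup E] [NormedSpace ℝ E] [FiniteDimensional ℝ E]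
  (h θ : E → E →L[ℝ] ℝ) (x : E)

/-- The field `R` with `dθ (R, ·) = 0` and `h R = 1`. -/
noncomputable def reebField : E := (metricForm h θ x).inverse (h x)

/-- The coefficient `f` in `dθ (X, ·) = θ + f h`. -/
noncomputable def liouvilleCoeff : ℝ := -h x ((metricForm h θ x).inverse (θ x))

/-- The field `X` in `ker h` with `dθ (X, ·) = θ` on `ker h`. -/
noncomputable def liouvilleField : E :=
  (metricForm h θ x).inverse (θ x) + liouvilleCoeff h θ x • reebField h θ x

variable {h θ x}

theorem exists_metricForm_equiv (H : NondegenerateOnKer (h x) (extd θ x))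
    (hodd : Odd (Module.finrank ℝ E)) :
    ∃ e : E ≃L[ℝ] (E →L[ℝ] ℝ), (e : E →L[ℝ] E →L[ℝ] ℝ) = metricForm h θ x := by
  have hinj : Injective (metricForm h θ x : E →ₗ[ℝ] E →L[ℝ] ℝ) := by
    rw [injective_iff_map_eq_zero]
    intro v hv
    exact H.eq_zero hodd fun w => congrArg (fun l : E →L[ℝ] ℝ => l w) hv
  have hdim : Module.finrank ℝ E = Module.finrank ℝ (E →L[ℝ] ℝ) := by
    rw [← (LinearMap.toContinuousLinearMap : (E →ₗ[ℝ] ℝ) ≃ₗ[ℝ] E →L[ℝ] ℝ).finrank_eq]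
    exact (Subspace.dual_finrank_eq (K := ℝ) (V := E)).symm
  refine ⟨(LinearEquiv.ofInjectiveOfFinrankEq _ hinj hdim).toContinuousLinearEquiv, ?_⟩
  ext v w
  rfl

theorem metricForm_inverse (H : NondegenerateOnKer (h x) (extd θ x))
    (hodd : Odd (Module.finrank ℝ E)) (l : E →L[ℝ] ℝ) (v : E) :
    metricForm h θ x ((metricForm h θ x).inverse l) v = l v := by
  obtain ⟨e, he⟩ := exists_metricForm_equiv H hodd
  rw [← he, ContinuousLinearMap.inverse_equiv]
  simp

/-- A Reeb vector R satisfies G(R, ·) = h, and G is injective, so R is the vector obtained by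
inverting G. -/
theorem reebField_spec (H : NondegenerateOnKer (h x) (extd θ x))
    (hodd : Odd (Module.finrank ℝ E)) :
    h x (reebField h θ x) = 1 ∧ ∀ v, extd θ x (reebField h θ x) v = 0 := by
  obtain ⟨R, hR1, hR⟩ := H.exists_reeb hodd
  have : reebField h θ x - R = 0 := by
    refine H.eq_zero hodd fun w => ?_
    have h1 := metricForm_inverse H hodd (h x) w
    rw [metricForm_apply] at h1
    have h2 := hR w
    simp only [reebField, map_sub, sub_apply, hR1]
    linear_combination h1 - h2
  rw [sub_eq_zero.1 this]
  exact ⟨hR1, hR⟩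

/-- The vector G⁻¹θ satisfies dθ(G⁻¹θ, ·) = θ + f h with f = -h(G⁻¹θ). Adding f R moves it into ker
h without changing its contraction with dθ. -/
theorem liouvilleField_spec (H : NondegenerateOnKer (h x) (extd θ x))
    (hodd : Odd (Module.finrank ℝ E)) :
    h x (liouvilleField h θ x) = 0 ∧
      ∀ v, extd θ x (liouvilleField h θ x) v = θ x v + liouvilleCoeff h θ x * h x v := by
  obtain ⟨hR1, hR⟩ := reebField_spec H hodd
  constructor
  · simp [liouvilleField, liouvilleCoeff, hR1]
  · intro v
    have h1 := metricForm_inverse H hodd (θ x) v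
    rw [metricForm_apply] at h1
    simp only [liouvilleField, map_add, map_smul, add_apply, smul_apply, hR, smul_zero, add_zero]
    rw [liouvilleCoeff]
    linear_combination h1

theorem contDiffAt_metricForm_inverse (hh : ContDiffAt ℝ ∞ h x) (hθ : ContDiffAt ℝ ∞ θ x)
    (H : NondegenerateOnKer (h x) (extd θ x)) (hodd : Odd (Module.finrank ℝ E)) :
    ContDiffAt ℝ ∞ (fun y => (metricForm h θ y).inverse) x := by
  obtain ⟨e, he⟩ := exists_metricForm_equiv H hodd
  have h1 := contDiffAt_map_inverse (n := ∞) e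
  rw [he] at h1
  exact h1.comp x (contDiffAt_metricForm hh hθ)

/-- The explicit formulas through G⁻¹ yield smoothness, since inversion of linear maps is smooth. -/
theorem contDiffAt_liouville (hh : ContDiffAt ℝ ∞ h x) (hθ : ContDiffAt ℝ ∞ θ x)
    (H : NondegenerateOnKer (h x) (extd θ x)) (hodd : Odd (Module.finrank ℝ E)) :
    ContDiffAt ℝ ∞ (liouvilleField h θ) x ∧ ContDiffAt ℝ ∞ (liouvilleCoeff h θ) x := by
  have h1 := contDiffAt_metricForm_inverse hh hθ H hodd
  have h2 : ContDiffAt ℝ ∞ (liouvilleCoeff h θ) x := (hh.clm_apply (h1.clm_apply hθ)).neg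
  exact ⟨(h1.clm_apply hθ).add (h2.smul (h1.clm_apply hh)), h2⟩

end LiouvilleField

/-! ### One-forms on manifolds and the obstruction to an expanding Liouville field. -/

section FormsOnManifolds

variable {E : Type*} [NormedAddCommGroup E] [NormedSpace ℝ E]
  {M : Type*} [TopologicalSpace M] [ChartedSpace E M]

/-- The representation in the chart at `c` of a 1-form; here the tangent space at `q` is identified
with `E` through the preferred chart at `q`. -/
noncomputable def chartForm (β : M → E →L[ℝ] ℝ) (c : M) (x : E) : E →L[ℝ] ℝ :=
  (β ((chartAt E c).symm x)).comp (fderiv ℝ (transition c ((chartAt E c).symm x)) x)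

/-- The exterior derivative at a point of a 1-form on a manifold. -/
noncomputable def extdAt (β : M → E →L[ℝ] ℝ) (q : M) : E →L[ℝ] E →L[ℝ] ℝ :=
  extd (chartForm β q) (chartAt E q q)

/-- Smoothness of a 1-form on a manifold. -/
def IsSmoothForm (β : M → E →L[ℝ] ℝ) : Prop :=
  ∀ q, ContDiffAt ℝ ∞ (chartForm β q) (chartAt E q q)

theorem symm_transition {c d : M} {x : E} (hx : x ∈ (transition c d).source) :
    (chartAt E d).symm (transition c d x) = (chartAt E c).symm x :=
  (chartAt E d).left_inv (mem_transition_source.1 hx).2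

theorem mem_transition_center {c : M} {x : E} (hx : x ∈ (chartAt E c).target) :
    x ∈ (transition c ((chartAt E c).symm x)).source :=
  mem_transition_source.2 ⟨hx, mem_chart_source E _⟩

variable [IsManifold 𝓘(ℝ, E) ∞ M]

theorem fderiv_transition_comp {c d e : M} {x : E} (hx : x ∈ (transition c d).source)
    (he : (chartAt E c).symm x ∈ (chartAt E e).source) :
    fderiv ℝ (transition c e) x =
      (fderiv ℝ (transition d e) (transition c d x)).comp (fderiv ℝ (transition c d) x) := by
  have hev : (transition c e : E → E) =ᶠ[𝓝 x] transition d e ∘ transition c d := by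
    filter_upwards [(transition c d).open_source.mem_nhds hx] with y hy
    rw [comp_apply, transition_apply d e, symm_transition hy, transition_apply]
  have hde : transition c d x ∈ (transition d e).source := by
    rw [mem_transition_source, symm_transition hx]
    exact ⟨(chartAt E d).map_source (mem_transition_source.1 hx).2, he⟩
  rw [hev.fderiv_eq, fderiv_comp x (hasFDerivAt_transition hde).differentiableAt
    (hasFDerivAt_transition hx).differentiableAt]

theorem fderiv_transition_self {c : M} {x : E} (hx : x ∈ (chartAt E c).target) :
    fderiv ℝ (transition c c) x = ContinuousLinearMap.id ℝ E := by
  have hev : (transition c c : E → E) =ᶠ[𝓝 x] id := by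
    filter_upwards [(chartAt E c).open_target.mem_nhds hx] with y hy
    rw [transition_apply, (chartAt E c).right_inv hy, id]
  rw [hev.fderiv_eq, fderiv_id]

theorem fderiv_transition_symm {c d : M} {x : E} (hx : x ∈ (transition c d).source) (v : E) :
    fderiv ℝ (transition d c) (transition c d x) (fderiv ℝ (transition c d) x v) = v := by
  have hc := (mem_transition_source.1 hx).1
  have h1 := fderiv_transition_comp hx ((chartAt E c).map_target hc)
  rw [fderiv_transition_self hc] at h1
  exact (congrArg (fun A : E →L[ℝ] E => A v) h1).symm

theorem transition_mem_source {c d : M} {x : E} (hx : x ∈ (transition c d).source) :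
    transition c d x ∈ (transition d c).source := by
  have h := mem_transition_source.1 hx
  rw [mem_transition_source, symm_transition hx]
  exact ⟨(chartAt E d).map_source h.2, (chartAt E c).map_target h.1⟩

theorem transition_transition {c d : M} {x : E} (hx : x ∈ (transition c d).source) :
    transition d c (transition c d x) = x := by
  rw [transition_apply d c, symm_transition hx,
    (chartAt E c).right_inv (mem_transition_source.1 hx).1]

theorem fderiv_transition_symm' {c d : M} {x : E} (hx : x ∈ (transition c d).source) (v : E) :
    fderiv ℝ (transition c d) x (fderiv ℝ (transition d c) (transition c d x) v) = v := by
  have h := fderiv_transition_symm (transition_mem_source hx) v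
  rwa [transition_transition hx] at h

theorem chartForm_self (β : M → E →L[ℝ] ℝ) (q : M) : chartForm β q (chartAt E q q) = β q := by
  have hq := mem_chart_source E q
  rw [chartForm, (chartAt E q).left_inv hq, fderiv_transition_self (mem_chart_target E q)]
  rfl

theorem chartForm_change (β : M → E →L[ℝ] ℝ) {c d : M} {x : E}
    (hx : x ∈ (transition c d).source) :
    chartForm β c x = (chartForm β d (transition c d x)).comp (fderiv ℝ (transition c d) x) := by
  rw [chartForm, chartForm, symm_transition hx,
    fderiv_transition_comp hx (mem_chart_source E _)]
  rfl

theorem chartForm_eventuallyEq (β : M → E →L[ℝ] ℝ) {c d : M} {x : E}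
    (hx : x ∈ (transition c d).source) :
    chartForm β c =ᶠ[𝓝 x] fun y =>
      (chartForm β d (transition c d y)).comp (fderiv ℝ (transition c d) y) := by
  filter_upwards [(transition c d).open_source.mem_nhds hx] with y hy
  exact chartForm_change β hy

/-- `IsSmoothForm` only concerns the centre of each preferred chart; the transformation law spreads
smoothness over the whole chart. -/
theorem IsSmoothForm.contDiffAt {β : M → E →L[ℝ] ℝ} (hβ : IsSmoothForm β) {c : M} {x : E}
    (hx : x ∈ (chartAt E c).target) : ContDiffAt ℝ ∞ (chartForm β c) x := by
  have hxs := mem_transition_center hx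
  refine ContDiffAt.congr_of_eventuallyEq ?_ (chartForm_eventuallyEq β hxs)
  have ht := contDiffAt_transition hxs
  exact (ContDiffAt.comp x (hβ _) ht).clm_comp (ht.fderiv_right (m := ∞) le_rfl)

theorem IsSmoothForm.extd_change {β : M → E →L[ℝ] ℝ} (hβ : IsSmoothForm β) {c d : M} {x : E}
    (hx : x ∈ (transition c d).source) (v w : E) :
    extd (chartForm β c) x v w = extd (chartForm β d) (transition c d x)
      (fderiv ℝ (transition c d) x v) (fderiv ℝ (transition c d) x w) :=
  extd_pullback (contDiffAt_transition hx)
    ((hβ.contDiffAt ((chartAt E d).map_source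
      (mem_transition_source.1 hx).2)).differentiableAt (by simp))
    (chartForm_eventuallyEq β hx) v w

theorem IsSmoothForm.extd_chartForm {β : M → E →L[ℝ] ℝ} (hβ : IsSmoothForm β) {c : M} {x : E}
    (hx : x ∈ (chartAt E c).target) (v w : E) :
    extd (chartForm β c) x v w = extdAt β ((chartAt E c).symm x)
      (fderiv ℝ (transition c ((chartAt E c).symm x)) x v)
      (fderiv ℝ (transition c ((chartAt E c).symm x)) x w) :=
  hβ.extd_change (mem_transition_center hx) v w

variable [FiniteDimensional ℝ E]

/-- On a compact manifold of dimension `2 n + 1` with a foliation `ker h` and a 1-form `θ` whose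
exterior derivative is nondegenerate on `ker h`, let `X` be the field in `ker h` with
`dθ (X, ·) = θ` on `ker h`. Then `n + lam` cannot be positive everywhere, where
`dh (X, ·) = lam h`. -/
theorem false_of_liouville_expanding [CompactSpace M] [T2Space M] [Nonempty M] {n : ℕ}
    (hdim : Module.finrank ℝ E = 2 * n + 1) {h θ : M → E →L[ℝ] ℝ} (hh : IsSmoothForm h)
    (hθ : IsSmoothForm θ) (hH : ∀ q, NondegenerateOnKer (h q) (extdAt θ q))
    (hflat : ∀ q v w, h q v = 0 → h q w = 0 → extdAt h q v w = 0)
    (hpos : ∀ q v lam, h q v = 0 → (∀ w, h q w = 0 → extdAt θ q v w = θ q w) →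
      (∀ w, extdAt h q v w = lam * h q w) → 0 < n + lam) : False := by
  classical
  have hodd : Odd (Module.finrank ℝ E) := ⟨n, hdim⟩
  let b := Module.finBasis ℝ E
  have hHc : ∀ c : M, ∀ x ∈ (chartAt E c).target,
      NondegenerateOnKer (chartForm h c x) (extd (chartForm θ c) x) := by
    intro c x hx
    have hxs := mem_transition_center hx
    have HH := hH ((chartAt E c).symm x)
    refine ⟨fun h0 => HH.ne_zero ?_, fun v w => extd_swap _ _ _ _, fun v hv hvw => ?_⟩
    · ext v
      have := congrArg (fun A : E →L[ℝ] ℝ => A (fderiv ℝ (transition ((chartAt E c).symm x) c)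
        (transition c ((chartAt E c).symm x) x) v)) h0
      simpa only [chartForm, ContinuousLinearMap.comp_apply, fderiv_transition_symm' hxs,
        zero_apply] using this
    · have h0 : fderiv ℝ (transition c ((chartAt E c).symm x)) x v = 0 := by
        refine HH.nondegenerate _ hv fun w hw => ?_
        have := hvw (fderiv ℝ (transition ((chartAt E c).symm x) c)
          (transition c ((chartAt E c).symm x) x) w)
          (by simpa only [chartForm, ContinuousLinearMap.comp_apply,
            fderiv_transition_symm' hxs] using hw)
        rwa [hθ.extd_chartForm hx, fderiv_transition_symm' hxs] at this
      have := fderiv_transition_symm hxs v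
      rwa [h0, map_zero, eq_comm] at this
  have hflatc : ∀ c : M, ∀ x ∈ (chartAt E c).target, ∀ v w, chartForm h c x v = 0 →
      chartForm h c x w = 0 → extd (chartForm h c) x v w = 0 := by
    intro c x hx v w hv hw
    rw [hh.extd_chartForm hx]
    exact hflat _ _ _ hv hw
  let ρ : M → E → ℝ := fun c x =>
    gramDensity b (metricForm (chartForm h c) (chartForm θ c) x)
  let X : M → E → E := fun c => liouvilleField (chartForm h c) (chartForm θ c)
  let R : M → E → E := fun c => reebField (chartForm h c) (chartForm θ c)
  have hdet : ∀ c : M, ∀ x ∈ (chartAt E c).target,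
      (gram b (metricForm (chartForm h c) (chartForm θ c) x)).det ≠ 0 := by
    intro c x hx h0
    obtain ⟨v, hv, hv0⟩ := exists_ne_zero_of_det_gram_eq_zero b h0
    exact hv ((hHc c x hx).eq_zero hodd hv0)
  have hsol := fun c x hx => liouvilleField_spec (hHc c x hx) hodd
  have hsolR := fun c x hx => reebField_spec (hHc c x hx) hodd
  -- The Liouville field is characterized by h(X) = 0 and dθ(X, ·) = θ on ker h. These conditions
  -- are independent of coordinates and determine X uniquely, so the local fields agree.
  have hchange : ∀ c d : M, ∀ x ∈ (transition c d).source,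
      X d (transition c d x) = fderiv ℝ (transition c d) x (X c x) := by
    intro c d x hx
    have hc := (mem_transition_source.1 hx).1
    have hd : transition c d x ∈ (chartAt E d).target :=
      (mem_transition_source.1 (transition_mem_source hx)).1
    obtain ⟨s1, s2⟩ := hsol c x hc
    obtain ⟨t1, t2⟩ := hsol d _ hd
    refine sub_eq_zero.1 ((hHc d _ hd).nondegenerate _ ?_ fun w hw => ?_)
    · rw [map_sub, t1, zero_sub, neg_eq_zero, ← s1, chartForm_change h hx]
      rfl
    · set w' := fderiv ℝ (transition d c) (transition c d x) w with hw'
      have hww : fderiv ℝ (transition c d) x w' = w := fderiv_transition_symm' hx w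
      have e1 : chartForm h c x w' = 0 := by
        rw [chartForm_change h hx, ContinuousLinearMap.comp_apply, hww, hw]
      have e2 : chartForm θ c x w' = chartForm θ d (transition c d x) w := by
        rw [chartForm_change θ hx, ContinuousLinearMap.comp_apply, hww]
      have e3 := s2 w'
      rw [hθ.extd_change hx, hww, e1, mul_zero, add_zero, e2] at e3
      have e4 := t2 w
      rw [hw, mul_zero, add_zero] at e4
      rw [map_sub, sub_apply]
      exact sub_eq_zero.2 (e4.trans e3.symm)
  have hDF : DensityField ρ X := by
    refine ⟨fun c x hx => gramDensity_pos b (hdet c x hx), fun c x hx => ?_, fun c x hx => ?_,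
      fun c d x hx => ?_, hchange⟩
    · exact (ContDiffAt.comp x (contDiffAt_gramDensity b (hdet c x hx))
        (contDiffAt_metricForm (hh.contDiffAt hx) (hθ.contDiffAt hx))).of_le (by simp)
    · exact (contDiffAt_liouville (hh.contDiffAt hx) (hθ.contDiffAt hx)
        (hHc c x hx) hodd).1.of_le (by simp)
    · refine gramDensity_pullback b _ _ fun v w => ?_
      rw [metricForm_apply, metricForm_apply, hθ.extd_change hx, chartForm_change h hx]
      rfl
  -- The multiplier in dh(X, ·) = λ h is found by evaluation on R, because h(R) = 1.
  let lam : M → ℝ := fun q => extdAt h q (X q (chartAt E q q)) (R q (chartAt E q q))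
  have hlam0 : ∀ q v, extdAt h q (X q (chartAt E q q)) v = lam q * h q v := by
    intro q v
    have hq := mem_chart_target E q
    have s1 := (hsol q _ hq).1
    have r1 := (hsolR q _ hq).1
    -- Remove the R-component of v: X and the remainder both lie in ker h, where dh vanishes.
    have hv : chartForm h q (chartAt E q q)
        (v - h q v • R q (chartAt E q q)) = 0 := by
      rw [map_sub, map_smul, r1, chartForm_self, smul_eq_mul, mul_one, sub_self]
    have := hflatc q _ hq _ _ s1 hv
    rw [map_sub, map_smul, smul_eq_mul, sub_eq_zero] at this
    rw [extdAt, this, mul_comm]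
    rfl
  have hlam : ∀ c : M, ∀ x ∈ (chartAt E c).target, ∀ v,
      extd (chartForm h c) x (X c x) v = lam ((chartAt E c).symm x) * chartForm h c x v := by
    intro c x hx v
    have e := hchange c _ x (mem_transition_center hx)
    rw [hh.extd_chartForm hx, ← e]
    exact hlam0 _ _
  refine hDF.false_of_divergence_pos (δ := fun q => n + lam q) (fun q => ?_) fun c x hx => ?_
  · obtain ⟨s1, s2⟩ := hsol q _ (mem_chart_target E q)
    rw [chartForm_self] at s1 s2
    refine hpos q _ _ s1 (fun w hw => ?_) (hlam0 q)
    have := s2 w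
    rwa [chartForm_self, hw, mul_zero, add_zero] at this
  · obtain ⟨r1, r2⟩ := hsolR c x hx
    have hs := contDiffAt_liouville (hh.contDiffAt hx) (hθ.contDiffAt hx) (hHc c x hx) hodd
    have hnhds := (chartAt E c).open_target.mem_nhds hx
    -- With κ = dh(·, R), the vanishing of dh on ker h gives dh = κ ∧ h, by splitting both arguments
    -- along R.
    have hkey := divergence_gramDensity_smul b (R := R c x) (X := X c)
      (f := liouvilleCoeff (chartForm h c) (chartForm θ c))
      (κ := (extd (chartForm h c) x).flip (R c x)) (lam := lam ((chartAt E c).symm x))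
      (hh.contDiffAt hx) (hθ.contDiffAt hx)
      (hs.1.differentiableAt (by simp)) (hs.2.differentiableAt (by simp)) (hdet c x hx)
      (Filter.eventually_of_mem hnhds fun y hy => (hsol c y hy).2)
      (Filter.eventually_of_mem hnhds fun y hy => (hsol c y hy).1) (hlam c x hx) ?_ r2 r1
    · have hcard : ((Module.finrank ℝ E : ℝ) - 1) / 2 = n := by
        rw [hdim]
        push_cast
        ring
      rw [hkey, Fintype.card_fin, hcard]
    · intro v w
      simp only [ContinuousLinearMap.flip_apply]
      have hker : ∀ u, chartForm h c x (u - chartForm h c x u • R c x) = 0 := by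
        intro u
        rw [map_sub, map_smul, r1, smul_eq_mul, mul_one, sub_self]
      have := hflatc c x hx _ _ (hker v) (hker w)
      simp only [map_sub, map_smul, sub_apply, smul_apply, smul_eq_mul,
        extd_self] at this
      rw [extd_swap _ _ (R c x) w] at this
      linear_combination this

end FormsOnManifolds

/-! ### Vector fields in charts, brackets, and smoothness criteria for 1-forms. -/

section Fields

variable {E : Type*} [NormedAddCommGroup E] [NormedSpace ℝ E]
  {M : Type*} [TopologicalSpace M] [ChartedSpace E M]

/-- The representation in the chart at `c` of a vector field. -/
noncomputable def chartField (V : M → E) (c : M) (x : E) : E :=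
  fderiv ℝ (transition ((chartAt E c).symm x) c)
    (chartAt E ((chartAt E c).symm x) ((chartAt E c).symm x)) (V ((chartAt E c).symm x))

/-- Smoothness of a vector field on a manifold. -/
def IsSmoothField [IsManifold 𝓘(ℝ, E) ∞ M] (V : M → E) : Prop :=
  ContMDiff 𝓘(ℝ, E) (𝓘(ℝ, E)).tangent ∞ (fun p => (⟨p, V p⟩ : TangentBundle 𝓘(ℝ, E) M))

/-- The Lie bracket of vector fields on a manifold. -/
noncomputable def fieldBracket (V W : M → E) : M → E :=
  VectorField.mlieBracket 𝓘(ℝ, E) (M := M) V W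

/-- The derivative at `p` of a function in the direction `v`. -/
noncomputable def dirDeriv (f : M → ℝ) (p : M) (v : E) : ℝ :=
  fderiv ℝ (fun y => f ((chartAt E p).symm y)) (chartAt E p p) v

variable [IsManifold 𝓘(ℝ, E) ∞ M]

theorem fderiv_transition_center {c : M} {x : E} (hx : x ∈ (chartAt E c).target) (v : E) :
    fderiv ℝ (transition c ((chartAt E c).symm x)) x
      (fderiv ℝ (transition ((chartAt E c).symm x) c)
        (chartAt E ((chartAt E c).symm x) ((chartAt E c).symm x)) v) = v :=
  fderiv_transition_symm' (mem_transition_center hx) v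

theorem chartForm_chartField (β : M → E →L[ℝ] ℝ) (V : M → E) {c : M}
    {x : E} (hx : x ∈ (chartAt E c).target) :
    chartForm β c x (chartField V c x) =
      β ((chartAt E c).symm x) (V ((chartAt E c).symm x)) := by
  rw [chartForm, chartField, ContinuousLinearMap.comp_apply, fderiv_transition_center hx]

theorem chartField_self (V : M → E) (q : M) :
    chartField V q (chartAt E q q) = V q := by
  rw [chartField, (chartAt E q).left_inv (mem_chart_source E q),
    fderiv_transition_self (mem_chart_target E q)]
  rfl

theorem contDiffAt_chartField {V : M → E}
    (hV : IsSmoothField V) (p : M) :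
    ContDiffAt ℝ ∞ (chartField V p) (chartAt E p p) := by
  have h1 := (Bundle.contMDiffAt_section p).1 (hV p)
  have h2 : ContMDiffAt 𝓘(ℝ, E) 𝓘(ℝ, E) ∞ (chartAt E p).symm (chartAt E p p) :=
    (contMDiffOn_chart_symm (I := 𝓘(ℝ, E)) (n := ∞) (x := p)).contMDiffAt
      ((chartAt E p).open_target.mem_nhds (mem_chart_target E p))
  have h3 := ContMDiffAt.comp_of_eq h1 h2 ((chartAt E p).left_inv (mem_chart_source E p))
  refine h3.contDiffAt.congr_of_eventuallyEq (Filter.Eventually.of_forall fun x => ?_)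
  rw [comp_apply, TangentBundle.trivializationAt_apply]
  simp [chartField, transition, fderivWithin_univ]

theorem mfderivWithin_chart_symm {c : M} {x : E} (hx : x ∈ (chartAt E c).target) :
    mfderivWithin 𝓘(ℝ, E) 𝓘(ℝ, E) (extChartAt 𝓘(ℝ, E) c).symm (range 𝓘(ℝ, E)) x =
      fderiv ℝ (transition c ((chartAt E c).symm x)) x := by
  have := mdifferentiableWithinAt_extChartAt_symm (I := 𝓘(ℝ, E)) (x := c) (z := x)
    (by simpa using hx)
  refine this.mfderivWithin.trans ?_
  simp [writtenInExtChartAt, transition, fderivWithin_univ, chartAt_self_eq]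
  rfl

/-- The pullback of a vector field under the inverse of the chart at `c`. -/
noncomputable def pullField (V : M → E) (c : M) : E → E :=
  VectorField.mpullbackWithin 𝓘(ℝ, E) 𝓘(ℝ, E) (extChartAt 𝓘(ℝ, E) c).symm V (range 𝓘(ℝ, E))

theorem pullField_eq (V : M → E) {c : M} {x : E} (hx : x ∈ (chartAt E c).target) :
    pullField V c x = chartField V c x := by
  have h1 : (fderiv ℝ (transition c ((chartAt E c).symm x)) x).inverse =
      fderiv ℝ (transition ((chartAt E c).symm x) c)
        (chartAt E ((chartAt E c).symm x) ((chartAt E c).symm x)) := by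
    have hs := mem_transition_center hx
    refine ContinuousLinearMap.inverse_eq ?_ ?_
    · ext v; exact fderiv_transition_symm' hs v
    · ext v; exact fderiv_transition_symm hs v
  exact congrArg (fun A : E →L[ℝ] E => A (V ((chartAt E c).symm x)))
    ((congrArg ContinuousLinearMap.inverse (mfderivWithin_chart_symm hx)).trans h1)

/-- The manifold bracket is computed by pulling back along the inverse chart at p. The derivative of
the preferred chart at its centre is the identity, so no correction factor remains. -/
theorem fieldBracket_eq (V W : M → E) (p : M) :
    fieldBracket V W p =
      VectorField.lieBracket ℝ (chartField V p) (chartField W p) (chartAt E p p) := by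
  have hev : ∀ U : M → E, pullField U p =ᶠ[𝓝 (chartAt E p p)] chartField U p := by
    intro U
    filter_upwards [(chartAt E p).open_target.mem_nhds (mem_chart_target E p)] with x hx
    exact pullField_eq U hx
  have h1 := Filter.EventuallyEq.lieBracket_vectorField_eq (𝕜 := ℝ) (hev V) (hev W)
  have h2 : (mfderiv 𝓘(ℝ, E) 𝓘(ℝ, E) (extChartAt 𝓘(ℝ, E) p) p).inverse =
      ContinuousLinearMap.id ℝ E := by
    rw [mfderiv_extChartAt_self]
    exact ContinuousLinearMap.inverse_id
  have hs : (extChartAt 𝓘(ℝ, E) p).symm ⁻¹' univ ∩ range 𝓘(ℝ, E) = univ := by simp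
  have h3 : VectorField.lieBracketWithin ℝ (pullField V p) (pullField W p)
      ((extChartAt 𝓘(ℝ, E) p).symm ⁻¹' univ ∩ range 𝓘(ℝ, E)) (chartAt E p p) =
      VectorField.lieBracket ℝ (pullField V p) (pullField W p) (chartAt E p p) := by
    rw [hs, VectorField.lieBracketWithin_univ]
  exact (congrArg (fun A : E →L[ℝ] E => A (VectorField.lieBracketWithin ℝ (pullField V p)
    (pullField W p) ((extChartAt 𝓘(ℝ, E) p).symm ⁻¹' univ ∩ range 𝓘(ℝ, E)) (chartAt E p p)))
    h2).trans (h3.trans h1)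

/-- `dβ (V, W) = V (β W) - W (β V) - β [V, W]`. -/
theorem extdAt_apply {β : M → E →L[ℝ] ℝ} (hβ : IsSmoothForm β)
    {V W : M → E}
    (hV : IsSmoothField V)
    (hW : IsSmoothField W) (p : M) :
    extdAt β p (V p) (W p) = dirDeriv (fun q => β q (W q)) p (V p)
      - dirDeriv (fun q => β q (V q)) p (W p) - β p (fieldBracket V W p) := by
  have hd := fun {U : M → E} (hU : IsSmoothField U) =>
    (contDiffAt_chartField hU p).differentiableAt (by simp)
  have hβd := (hβ p).differentiableAt (by simp)
  have key : ∀ {U : M → E}, IsSmoothField U → ∀ v : E,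
      dirDeriv (fun q => β q (U q)) p v = fderiv ℝ (chartForm β p) (chartAt E p p) v (U p)
        + β p (fderiv ℝ (chartField U p) (chartAt E p p) v) := by
    intro U hU v
    have hev : (fun y => β ((chartAt E p).symm y) (U ((chartAt E p).symm y)))
        =ᶠ[𝓝 (chartAt E p p)] fun y => chartForm β p y (chartField U p y) := by
      filter_upwards [(chartAt E p).open_target.mem_nhds (mem_chart_target E p)] with x hx
      exact (chartForm_chartField β U hx).symm
    rw [dirDeriv, hev.fderiv_eq, (hβd.hasFDerivAt.clm_apply (hd hU).hasFDerivAt).fderiv]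
    simp only [add_apply, ContinuousLinearMap.comp_apply, ContinuousLinearMap.flip_apply,
      chartForm_self, chartField_self]
    ring
  rw [key hV, key hW, fieldBracket_eq, VectorField.lieBracket, map_sub, extdAt, extd_apply,
    chartField_self, chartField_self]
  ring

theorem contDiffAt_form_apply {β : M → E →L[ℝ] ℝ} (hβ : IsSmoothForm β)
    {V : M → E}
    (hV : IsSmoothField V) (p : M) :
    ContDiffAt ℝ ∞ (fun y => β ((chartAt E p).symm y) (V ((chartAt E p).symm y)))
      (chartAt E p p) := by
  refine ((hβ p).clm_apply (contDiffAt_chartField hV p)).congr_of_eventuallyEq ?_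
  filter_upwards [(chartAt E p).open_target.mem_nhds (mem_chart_target E p)] with x hx
  exact (chartForm_chartField β V hx).symm

/-- A 1-form which is smooth on a local frame is smooth. -/
theorem isSmoothForm_of_frame [FiniteDimensional ℝ E] {ι : Type*} [Fintype ι]
    {β : M → E →L[ℝ] ℝ}
    (hβ : ∀ p : M, ∃ V : ι → M → E,
      (∀ i, IsSmoothField (V i)) ∧
      (LinearIndependent ℝ (fun i => (V i p : E)) ∧ Fintype.card ι = Module.finrank ℝ E) ∧
      ∀ i, ContDiffAt ℝ ∞ (fun y => β ((chartAt E p).symm y) (V i ((chartAt E p).symm y)))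
        (chartAt E p p)) : IsSmoothForm β := by
  intro p
  obtain ⟨V, hV, ⟨hli, hcard⟩, hs⟩ := hβ p
  -- Φ sends coefficients to combinations of the frame, and a = β ∘ Φ has smooth coefficients by
  -- hypothesis. Φ is invertible at the centre, hence nearby, so β = a ∘ Φ⁻¹ is smooth.
  let Φ : E → (ι → ℝ) →L[ℝ] E := fun y =>
    ∑ i, (ContinuousLinearMap.proj i : (ι → ℝ) →L[ℝ] ℝ).smulRight (chartField (V i) p y)
  have hΦs : ContDiffAt ℝ ∞ Φ (chartAt E p p) :=
    ContDiffAt.sum fun i _ => contDiffAt_const.smulRight (contDiffAt_chartField (hV i) p)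
  obtain ⟨e, he⟩ : ∃ e : (ι → ℝ) ≃L[ℝ] E, (e : (ι → ℝ) →L[ℝ] E) = Φ (chartAt E p p) := by
    have hinj : Injective (Φ (chartAt E p p) : (ι → ℝ) →ₗ[ℝ] E) := by
      rw [injective_iff_map_eq_zero]
      intro r hr
      have h0 : ∑ i, r i • (V i p : E) = 0 := by
        simpa [Φ, chartField_self] using hr
      exact funext (Fintype.linearIndependent_iff.1 hli r h0)
    have hdim : Module.finrank ℝ (ι → ℝ) = Module.finrank ℝ E := by
      rw [Module.finrank_fintype_fun_eq_card, hcard]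
    refine ⟨(LinearEquiv.ofInjectiveOfFinrankEq _ hinj hdim).toContinuousLinearEquiv, ?_⟩
    ext v
    rfl
  have hinv : ContDiffAt ℝ ∞ (fun y => (Φ y).inverse) (chartAt E p p) := by
    have h1 := contDiffAt_map_inverse (n := ∞) e
    rw [he] at h1
    exact h1.comp _ hΦs
  let a : E → (ι → ℝ) →L[ℝ] ℝ := fun y => ∑ i,
    (ContinuousLinearMap.proj i : (ι → ℝ) →L[ℝ] ℝ).smulRight
      (β ((chartAt E p).symm y) (V i ((chartAt E p).symm y)))
  have ha : ContDiffAt ℝ ∞ a (chartAt E p p) :=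
    ContDiffAt.sum fun i _ => contDiffAt_const.smulRight (hs i)
  refine (ha.clm_comp hinv).congr_of_eventuallyEq ?_
  have hn : ∀ᶠ y in 𝓝 (chartAt E p p),
      Φ y ∈ range ((↑) : ((ι → ℝ) ≃L[ℝ] E) → (ι → ℝ) →L[ℝ] E) :=
    hΦs.continuousAt.eventually (he ▸ e.nhds)
  filter_upwards [hn, (chartAt E p).open_target.mem_nhds (mem_chart_target E p)] with y hy hyt
  obtain ⟨e', he'⟩ := hy
  have hcomp : (chartForm β p y).comp (Φ y) = a y := by
    ext r
    simp [Φ, a, chartForm_chartField β _ hyt]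
  rw [← hcomp, ← he', ContinuousLinearMap.inverse_equiv]
  ext v
  simp

/-- The imaginary part of a smooth section of `Hom(TM, ℂ)` is a smooth 1-form. -/
theorem isSmoothForm_im {form : ∀ p : M, TangentSpace 𝓘(ℝ, E) p →L[ℝ] ℂ}
    (hs : ContMDiff 𝓘(ℝ, E) (𝓘(ℝ, E).prod 𝓘(ℝ, E →L[ℝ] ℂ)) ∞
      (fun p => Bundle.TotalSpace.mk' (E →L[ℝ] ℂ)
        (E := fun p : M => TangentSpace 𝓘(ℝ, E) p →L[ℝ] Bundle.Trivial M ℂ p) p (form p))) :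
    IsSmoothForm (E := E) (fun p => Complex.imCLM.comp (form p : E →L[ℝ] ℂ)) := by
  intro p
  have h1 := ((contMDiffAt_hom_bundle _).1 (hs p)).2
  have h2 : ContMDiffAt 𝓘(ℝ, E) 𝓘(ℝ, E) ∞ (chartAt E p).symm (chartAt E p p) :=
    (contMDiffOn_chart_symm (I := 𝓘(ℝ, E)) (n := ∞) (x := p)).contMDiffAt
      ((chartAt E p).open_target.mem_nhds (mem_chart_target E p))
  have h3 := ContMDiffAt.comp_of_eq h1 h2 ((chartAt E p).left_inv (mem_chart_source E p))
  have h4 := (Complex.imCLM.postcomp E (σ := RingHom.id ℝ)).contDiff.contDiffAt.comp _ h3.contDiffAt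
  refine h4.congr_of_eventuallyEq ?_
  filter_upwards [(chartAt E p).open_target.mem_nhds (mem_chart_target E p)] with x hx
  have hq : (chartAt E p).symm x ∈ (chartAt E p).source := (chartAt E p).map_target hx
  ext v
  -- The inverse trivialization of the tangent bundle is the derivative of the coordinate change
  -- used in `chartForm`.
  have hA : (trivializationAt E (TangentSpace 𝓘(ℝ, E)) p).symmL ℝ ((chartAt E p).symm x) =
      fderiv ℝ (transition p ((chartAt E p).symm x)) x := by
    refine (TangentBundle.symmL_trivializationAt_eq_core hq).trans ?_
    rw [tangentBundleCore_coordChange_achart]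
    have hx' : extChartAt 𝓘(ℝ, E) p ((chartAt E p).symm x) = x := by
      simpa using (chartAt E p).right_inv hx
    rw [hx']
    simp [transition, fderivWithin_univ]
    rfl
  simp only [comp_apply, ContinuousLinearMap.inCoordinates]
  refine congrArg (fun A : E →L[ℝ] E => (form ((chartAt E p).symm x) (A v)).im) hA.symm |>.trans ?_
  have hB : (trivializationAt ℂ (Bundle.Trivial M ℂ) p).continuousLinearMapAt ℝ
      ((chartAt E p).symm x) = ContinuousLinearMap.id ℝ ℂ :=
    Bundle.Trivial.continuousLinearMapAt_trivialization ℝ M ℂ _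
  exact congrArg (fun A : ℂ →L[ℝ] ℂ => (A (form ((chartAt E p).symm x)
    ((trivializationAt E (TangentSpace 𝓘(ℝ, E)) p).symmL ℝ ((chartAt E p).symm x) v))).im) hB.symm

end Fields

/-! ### Real and imaginary parts; identification of T^{1,0} with ker h. -/

section Complexification

variable {n : ℕ} {M : Type*} [TopologicalSpace M] [ChartedSpace (Model n) M]
  [IsManifold 𝓘(ℝ, Model n) ∞ M] {p : M}

variable (p) in
/-- Every tangent space is the model space. -/
def ofModel : Model n ≃ₗ[ℝ] RTangent n M p := LinearEquiv.refl ℝ (Model n)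

variable (p) in
/-- The complex tangent vector `x + i y`. -/
noncomputable def cpair (x y : Model n) : CTangent n M p :=
  (1 : ℂ) ⊗ₜ[ℝ] ofModel p x + Complex.I ⊗ₜ[ℝ] ofModel p y

/-- The real part of a complex tangent vector. -/
noncomputable def rePart : CTangent n M p →ₗ[ℝ] Model n :=
  (ofModel p).symm.toLinearMap ∘ₗ (TensorProduct.lid ℝ (RTangent n M p)).toLinearMap ∘ₗ
    LinearMap.rTensor (RTangent n M p) Complex.reLm

/-- The imaginary part of a complex tangent vector. -/
noncomputable def imPart : CTangent n M p →ₗ[ℝ] Model n :=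
  (ofModel p).symm.toLinearMap ∘ₗ (TensorProduct.lid ℝ (RTangent n M p)).toLinearMap ∘ₗ
    LinearMap.rTensor (RTangent n M p) Complex.imLm

theorem rePart_tmul (z : ℂ) (x : RTangent n M p) :
    rePart (z ⊗ₜ[ℝ] x : CTangent n M p) = z.re • (ofModel p).symm x := by
  simp [rePart]

theorem imPart_tmul (z : ℂ) (x : RTangent n M p) :
    imPart (z ⊗ₜ[ℝ] x : CTangent n M p) = z.im • (ofModel p).symm x := by
  simp [imPart]

theorem rePart_cpair (x y : Model n) : rePart (cpair (M := M) p x y) = x := by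
  rw [cpair, map_add, rePart_tmul, rePart_tmul]; simp

theorem imPart_cpair (x y : Model n) : imPart (cpair (M := M) p x y) = y := by
  rw [cpair, map_add, imPart_tmul, imPart_tmul]; simp

theorem cpair_rePart_imPart (v : CTangent n M p) : cpair p (rePart v) (imPart v) = v := by
  induction v using TensorProduct.induction_on with
  | zero => simp [cpair]
  | tmul z x =>
    rw [rePart_tmul, imPart_tmul, cpair, map_smul, map_smul, LinearEquiv.apply_symm_apply,
      TensorProduct.tmul_smul, TensorProduct.tmul_smul, TensorProduct.smul_tmul',
      TensorProduct.smul_tmul', ← TensorProduct.add_tmul]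
    congr 1
    apply Complex.ext <;> simp
  | add a b ha hb =>
    conv_rhs => rw [← ha, ← hb]
    rw [cpair, map_add, map_add, map_add, map_add, TensorProduct.tmul_add, TensorProduct.tmul_add,
      add_add_add_comm]
    rfl

theorem ctangent_ext {v w : CTangent n M p} (hr : rePart v = rePart w)
    (hi : imPart v = imPart w) : v = w := by
  rw [← cpair_rePart_imPart v, ← cpair_rePart_imPart w, hr, hi]

/-- The real part of a complex vector field. -/
def reField (X : CVectorField n M) : M → Model n := X.re

/-- The imaginary part of a complex vector field. -/
def imField (X : CVectorField n M) : M → Model n := X.im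

theorem rePart_val (X : CVectorField n M) (p : M) : rePart (X.val p) = reField X p :=
  rePart_cpair _ _

theorem imPart_val (X : CVectorField n M) (p : M) : imPart (X.val p) = imField X p :=
  imPart_cpair _ _

theorem rePart_smul (z : ℂ) (v : CTangent n M p) :
    rePart (z • v) = z.re • rePart v - z.im • imPart v := by
  induction v using TensorProduct.induction_on with
  | zero => simp
  | tmul w x =>
    rw [TensorProduct.smul_tmul', rePart_tmul, imPart_tmul, rePart_tmul, smul_eq_mul,
      Complex.mul_re, sub_smul, mul_smul, mul_smul]
  | add a b ha hb => rw [smul_add, map_add, map_add, map_add, ha, hb]; module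

theorem imPart_smul (z : ℂ) (v : CTangent n M p) :
    imPart (z • v) = z.re • imPart v + z.im • rePart v := by
  induction v using TensorProduct.induction_on with
  | zero => simp
  | tmul w x =>
    rw [TensorProduct.smul_tmul', rePart_tmul, imPart_tmul, imPart_tmul, smul_eq_mul,
      Complex.mul_im, add_smul, mul_smul, mul_smul]
  | add a b ha hb => rw [smul_add, map_add, map_add, map_add, ha, hb]; module

theorem rePart_conjC (v : CTangent n M p) : rePart (conjC n M p v) = rePart v := by
  induction v using TensorProduct.induction_on with
  | zero => simp
  | tmul z x => rw [conjC_tmul, rePart_tmul, rePart_tmul, Complex.conj_re]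
  | add a b ha hb => rw [map_add, map_add, map_add, ha, hb]

theorem imPart_conjC (v : CTangent n M p) : imPart (conjC n M p v) = -imPart v := by
  induction v using TensorProduct.induction_on with
  | zero => simp
  | tmul z x => rw [conjC_tmul, imPart_tmul, imPart_tmul, Complex.conj_im, neg_smul]
  | add a b ha hb => rw [map_add, map_add, map_add, ha, hb, neg_add]

namespace CRStructure

variable {S : CRStructure n M}

theorem conjC_mem_T01 {v : CTangent n M p} (hv : v ∈ S.T10 p) : conjC n M p v ∈ S.T01 p := by
  change conjC n M p (conjC n M p v) ∈ S.T10 p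
  rwa [conjC_conjC]

/-- A purely imaginary vector is minus its conjugate, so in T^{1,0} it also lies in T^{0,1}. Thus
the real part is injective on T^{1,0}. -/
theorem eq_zero_of_rePart_eq_zero {v : CTangent n M p} (hv : v ∈ S.T10 p) (h0 : rePart v = 0) :
    v = 0 := by
  refine Submodule.disjoint_def.1 (S.disjoint p) v hv ?_
  have : conjC n M p v = -v := by
    apply ctangent_ext
    · rw [rePart_conjC, map_neg, h0, neg_zero]
    · rw [imPart_conjC, map_neg]
  change conjC n M p v ∈ S.T10 p
  rw [this]
  exact (S.T10 p).neg_mem hv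

theorem eq_of_rePart_eq {v w : CTangent n M p} (hv : v ∈ S.T10 p) (hw : w ∈ S.T10 p)
    (h : rePart v = rePart w) : v = w :=
  sub_eq_zero.1 (eq_zero_of_rePart_eq_zero ((S.T10 p).sub_mem hv hw) (by rw [map_sub, h, sub_self]))

/-- The real 1-form `h` with `η = i h`. -/
noncomputable def Trivialization.realForm (η : S.Trivialization) (p : M) : Model n →L[ℝ] ℝ :=
  Complex.imCLM.comp (η.form p : Model n →L[ℝ] ℂ)

theorem Trivialization.isSmoothForm_realForm (η : S.Trivialization) :
    IsSmoothForm (E := Model n) η.realForm :=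
  isSmoothForm_im η.smooth

theorem Trivialization.form_ofModel (η : S.Trivialization) (p : M) (x : Model n) :
    η.form p (ofModel p x) = Complex.I * η.realForm p x := by
  have h : (η.realForm p x : ℝ) = (η.form p (ofModel p x)).im := rfl
  rw [h]
  apply Complex.ext
  · simpa using η.imaginary p (ofModel p x)
  · simp

theorem Trivialization.ext_eq (η : S.Trivialization) (v : CTangent n M p) :
    η.ext p v = Complex.I * η.realForm p (rePart v) - η.realForm p (imPart v) := by
  conv_lhs => rw [← cpair_rePart_imPart v]
  rw [Trivialization.ext, cpair, map_add, LinearMap.liftBaseChange_tmul,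
    LinearMap.liftBaseChange_tmul, ContinuousLinearMap.coe_coe, η.form_ofModel, η.form_ofModel,
    one_smul, smul_eq_mul, ← mul_assoc, Complex.I_mul_I]
  ring

theorem Trivialization.mem_sup_iff (η : S.Trivialization) (v : CTangent n M p) :
    v ∈ S.T10 p ⊔ S.T01 p ↔ η.realForm p (rePart v) = 0 ∧ η.realForm p (imPart v) = 0 := by
  rw [← η.ker_ext, LinearMap.mem_ker, η.ext_eq, Complex.ext_iff]
  simp
  tauto

theorem Trivialization.realForm_rePart (η : S.Trivialization) {v : CTangent n M p}
    (hv : v ∈ S.T10 p) : η.realForm p (rePart v) = 0 :=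
  ((η.mem_sup_iff v).1 (Submodule.mem_sup_left hv)).1

theorem Trivialization.realForm_imPart (η : S.Trivialization) {v : CTangent n M p}
    (hv : v ∈ S.T10 p) : η.realForm p (imPart v) = 0 :=
  ((η.mem_sup_iff v).1 (Submodule.mem_sup_left hv)).2

theorem Trivialization.realForm_ne_zero (η : S.Trivialization) (p : M) : η.realForm p ≠ 0 := by
  intro h
  apply η.nonvanishing p
  ext x
  refine (η.form_ofModel p ((ofModel p).symm x)).trans ?_
  simp [h]

/-- Write the real vector x as u + w with u in T^{1,0} and w in T^{0,1}; then u + w̄ lies in T^{1,0}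
and has the same real part. So Re maps T^{1,0} onto ker h. -/
theorem Trivialization.exists_mem_T10 (η : S.Trivialization) {x : Model n}
    (hx : η.realForm p x = 0) : ∃ v ∈ S.T10 p, rePart v = x := by
  have hm : cpair p x 0 ∈ S.T10 p ⊔ S.T01 p := by
    rw [η.mem_sup_iff, rePart_cpair, imPart_cpair]
    simpa using hx
  obtain ⟨u, hu, w, hw, huw⟩ := Submodule.mem_sup.1 hm
  refine ⟨u + conjC n M p w, (S.T10 p).add_mem hu hw, ?_⟩
  rw [map_add, rePart_conjC, ← map_add, huw, rePart_cpair]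

/-- The real vector fields underlying a frame of `T^{1,0}` and a transversal vector. -/
def realFrame (L : Fin n → CVectorField n M) (W : M → Model n) :
    Fin n ⊕ Fin n ⊕ Unit → M → Model n :=
  Sum.elim (fun i => reField (L i)) (Sum.elim (fun i => imField (L i)) (fun _ => W))

theorem Trivialization.linearIndependent_realFrame (η : S.Trivialization)
    {L : Fin n → CVectorField n M} {W : M → Model n} (hW : η.realForm p (W p) ≠ 0)
    (hL : LinearIndependent ℂ (fun i => (L i).val p)) (hLS : ∀ i, (L i).val p ∈ S.T10 p) :
    LinearIndependent ℝ (fun i => realFrame L W i p) := by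
  rw [Fintype.linearIndependent_iff]
  intro g hg
  simp only [Fintype.sum_sum_type, realFrame, Sum.elim_inl, Sum.elim_inr,
    Finset.univ_unique, Finset.sum_singleton] at hg
  have h1 : ∀ i, η.realForm p (reField (L i) p) = 0 := fun i => by
    rw [← rePart_val]; exact η.realForm_rePart (hLS i)
  have h2 : ∀ i, η.realForm p (imField (L i) p) = 0 := fun i => by
    rw [← imPart_val]; exact η.realForm_imPart (hLS i)
  have hc : g (Sum.inr (Sum.inr default)) = 0 := by
    have := congrArg (η.realForm p) hg
    simp only [map_add, map_sum, map_smul, map_zero] at this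
    erw [Finset.sum_eq_zero (fun i _ => by rw [h1, smul_zero]), Finset.sum_eq_zero
      (fun i _ => by rw [h2, smul_zero])] at this
    simpa [hW] using this
  -- Since Re((a - ib)(X + iY)) = aX + bY, the real relation is the real part of a complex
  -- combination of the L_i, which therefore vanishes.
  have hv := eq_zero_of_rePart_eq_zero (S := S) (p := p)
    (v := ∑ i, (⟨g (Sum.inl i), -g (Sum.inr (Sum.inl i))⟩ : ℂ) • (L i).val p)
    (Submodule.sum_mem _ fun i _ => Submodule.smul_mem _ _ (hLS i)) (by
      rw [map_sum]
      simp only [rePart_smul, rePart_val, imPart_val, neg_smul, sub_neg_eq_add,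
        Finset.sum_add_distrib]
      rw [hc, zero_smul, add_zero] at hg
      exact hg)
  have hz := Fintype.linearIndependent_iff.1 hL _ hv
  rintro (i | i | i)
  · exact congrArg Complex.re (hz i)
  · simpa using congrArg Complex.im (hz i)
  · exact hc

end CRStructure

end Complexification

/-! ### Brackets and derivatives split into real and imaginary parts. -/

section Brackets

variable {n : ℕ} {M : Type*} [TopologicalSpace M] [ChartedSpace (Model n) M]
  [IsManifold 𝓘(ℝ, Model n) ∞ M] {p : M}

theorem isSmoothField_reField (X : CVectorField n M) : IsSmoothField (reField X) := X.smooth_re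

theorem isSmoothField_imField (X : CVectorField n M) : IsSmoothField (imField X) := X.smooth_im

theorem fieldBracket_neg_right {V W : M → Model n} (hW : IsSmoothField W) (p : M) :
    fieldBracket V (-W) p = -fieldBracket V W p := by
  have h1 := VectorField.mlieBracket_const_smul_right (I := 𝓘(ℝ, Model n)) (V := V) (W := W) (x := p)
    (c := (-1 : ℝ)) ((hW p).mdifferentiableAt (by simp))
  have h2 : (-1 : ℝ) • W = -W := by simp
  have h3 : (-1 : ℝ) • fieldBracket V W p = -fieldBracket V W p := by simp
  exact (congrArg (fun U => fieldBracket V U p) h2.symm).trans (h1.trans h3)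

theorem fieldBracket_swap (V W : M → Model n) (p : M) :
    fieldBracket V W p = -fieldBracket W V p :=
  VectorField.mlieBracket_swap_apply

theorem fieldBracket_neg_left {V W : M → Model n} (hV : IsSmoothField V) (p : M) :
    fieldBracket (-V) W p = -fieldBracket V W p := by
  rw [fieldBracket_swap, fieldBracket_neg_right hV, fieldBracket_swap V]

theorem fieldBracket_zero_left (W : M → Model n) (p : M) : fieldBracket 0 W p = 0 :=
  congrFun (VectorField.mlieBracket_zero_left (I := 𝓘(ℝ, Model n)) (W := W)) p

theorem rePart_bracket (X Y : CVectorField n M) (p : M) :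
    rePart (bracket X Y p) = fieldBracket (reField X) (reField Y) p
      - fieldBracket (imField X) (imField Y) p :=
  rePart_cpair _ _

theorem imPart_bracket (X Y : CVectorField n M) (p : M) :
    imPart (bracket X Y p) = fieldBracket (reField X) (imField Y) p
      + fieldBracket (imField X) (reField Y) p :=
  imPart_cpair _ _

theorem reField_conj (X : CVectorField n M) : reField X.conj = reField X := rfl

theorem imField_conj (X : CVectorField n M) : imField X.conj = -imField X := rfl

theorem dirDeriv_eq_zero {f : M → ℝ} {c : ℝ} (hf : ∀ q, f q = c) (p : M) (v : Model n) :
    dirDeriv f p v = 0 := by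
  simp [dirDeriv, hf]

/-- The real differential of a function given by its real and imaginary parts. -/
theorem realDiff_add_I_mul {a b : M → ℝ}
    (ha : ContDiffAt ℝ ∞ (fun y => a ((chartAt (Model n) p).symm y)) (chartAt (Model n) p p))
    (hb : ContDiffAt ℝ ∞ (fun y => b ((chartAt (Model n) p).symm y)) (chartAt (Model n) p p))
    (v : Model n) :
    realDiff (n := n) (fun q => (a q : ℂ) + Complex.I * b q) p v =
      dirDeriv a p v + Complex.I * dirDeriv b p v := by
  have ha' := Complex.ofRealCLM.hasFDerivAt.comp _ (ha.differentiableAt (by simp)).hasFDerivAt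
  have hb' := Complex.ofRealCLM.hasFDerivAt.comp _ (hb.differentiableAt (by simp)).hasFDerivAt
  have hf := ha'.add (hb'.const_mul Complex.I)
  have hm : MDifferentiableAt 𝓘(ℝ, Model n) 𝓘(ℝ, ℂ) (fun q => (a q : ℂ) + Complex.I * b q) p := by
    have h1 : MDifferentiableAt 𝓘(ℝ, Model n) 𝓘(ℝ, Model n) (chartAt (Model n) p) p :=
      mdifferentiableAt_atlas (chart_mem_atlas _ p) (mem_chart_source _ p)
    have h2 := hf.differentiableAt.mdifferentiableAt.comp p h1
    refine h2.congr_of_eventuallyEq ?_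
    filter_upwards [(chartAt (Model n) p).open_source.mem_nhds (mem_chart_source _ p)] with q hq
    simp [(chartAt (Model n) p).left_inv hq]
  have h3 : realDiff (n := n) (fun q => (a q : ℂ) + Complex.I * b q) p = _ :=
    (hm.mfderiv.trans (by simp [writtenInExtChartAt, fderivWithin_univ]; rfl)).trans hf.fderiv
  exact (congrArg (fun A : Model n →L[ℝ] ℂ => A v) h3).trans (by simp [dirDeriv])

end Brackets

namespace CRStructure

/-! ### Extension of vectors to sections, and the pointwise construction of θ. -/

section Sections

variable {n : ℕ} {M : Type*} [TopologicalSpace M] [ChartedSpace (Model n) M]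
  [IsManifold 𝓘(ℝ, Model n) ∞ M] {S : CRStructure n M} {p : M}

/-- Every vector of `T^{1,0}` extends to a global section. -/
theorem exists_section [T2Space M] {v : CTangent n M p} (hv : v ∈ S.T10 p) :
    ∃ L : CVectorField n M, S.IsSection10 L ∧ L.val p = v := by
  obtain ⟨L, hL⟩ := S.frame p
  have hv' := hv
  rw [← hL.self_of_nhds.2, Submodule.mem_span_range_iff_exists_fun] at hv'
  obtain ⟨c, hc⟩ := hv'
  -- The bump function is supported where the local frame takes values in T^{1,0}, so the cut-off
  -- combination is a global section.
  obtain ⟨f, -, hf⟩ := (SmoothBumpFunction.nhds_basis_tsupport (I := 𝓘(ℝ, Model n)) p).mem_iff.1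
    (hL.mono fun q hq => hq.2.le)
  have hs : ∀ a b : Fin n → ℝ, IsSmoothField
      ((f : M → ℝ) • ∑ i, (a i • reField (L i) + b i • imField (L i)) : M → Model n) := by
    intro a b
    refine ContMDiff.smul_section (V := fun q : M => RTangent n M q) f.contMDiff ?_
    have h := ContMDiff.sum_section (V := fun q : M => RTangent n M q) (s := Finset.univ)
      (t := fun i => a i • (L i).re + b i • (L i).im) (I := 𝓘(ℝ, Model n)) (n := ∞)
      (F := Model n) fun i _ =>
      ((L i).smooth_re.const_smul_section (a := a i)).add_section
        ((L i).smooth_im.const_smul_section (a := b i))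
    convert h using 2 with q
    simp [reField, imField]
    rfl
  let N : CVectorField n M :=
    { re := (f : M → ℝ) • ∑ i, ((c i).re • reField (L i) + (-(c i).im) • imField (L i))
      im := (f : M → ℝ) • ∑ i, ((c i).im • reField (L i) + (c i).re • imField (L i))
      smooth_re := hs _ _
      smooth_im := hs _ _ }
  have hN : ∀ q, N.val q = (f q : ℂ) • ∑ i, c i • (L i).val q := by
    intro q
    apply ctangent_ext
    · rw [rePart_val, rePart_smul, map_sum, map_sum]
      simp only [rePart_smul, imPart_smul, rePart_val, imPart_val, Complex.ofReal_re,
        Complex.ofReal_im, zero_smul, sub_zero]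
      change ((f : M → ℝ) • ∑ i, ((c i).re • reField (L i) + (-(c i).im) • imField (L i)) : M → Model n) q = _
      simp [sub_eq_add_neg]
    · rw [imPart_val, imPart_smul, map_sum, map_sum]
      simp only [rePart_smul, imPart_smul, rePart_val, imPart_val, Complex.ofReal_re,
        Complex.ofReal_im, zero_smul, add_zero]
      change ((f : M → ℝ) • ∑ i, ((c i).im • reField (L i) + (c i).re • imField (L i)) : M → Model n) q = _
      simp [add_comm]
  refine ⟨N, fun q => ?_, ?_⟩
  · rw [hN]
    by_cases hq : q ∈ tsupport f
    · exact Submodule.smul_mem _ _ (Submodule.sum_mem _ fun i _ => Submodule.smul_mem _ _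
        (hf hq (Submodule.subset_span ⟨i, rfl⟩)))
    · rw [image_eq_zero_of_notMem_tsupport hq, Complex.ofReal_zero, zero_smul]
      exact Submodule.zero_mem _
  · rw [hN, f.eq_one, Complex.ofReal_one, one_smul, hc]

/-- Multiplication by i sends X + iY to -Y + iX, so complex linearity forces Re L_i ↦ a(Im L_i) and
Im L_i ↦ -a(Re L_i). With w these real and imaginary parts form a basis. -/
theorem Trivialization.exists_realOneForm (η : S.Trivialization) {w : Model n}
    (hw : η.realForm p w ≠ 0) (a : Model n →L[ℝ] ℝ) :
    ∃ t : Model n →L[ℝ] ℝ, t w = 0 ∧ ∀ v ∈ S.T10 p, t (rePart v) = a (imPart v) := by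
  obtain ⟨L, hL⟩ := S.frame p
  obtain ⟨hli, hspan⟩ := hL.self_of_nhds
  have hmem : ∀ i, (L i).val p ∈ S.T10 p := fun i => hspan ▸ Submodule.subset_span ⟨i, rfl⟩
  have hr := η.linearIndependent_realFrame (W := fun _ => w) hw hli hmem
  let b := basisOfLinearIndependentOfCardEqFinrank hr (by
    simp only [Fintype.card_sum, Fintype.card_fin, Fintype.card_unit, finrank_euclideanSpace]; ring)
  have hb : ∀ i, b i = realFrame L (fun _ => w) i p := fun i => by simp [b]
  let t : Model n →ₗ[ℝ] ℝ := b.constr ℝ (Sum.elim (fun i => a (imField (L i) p))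
    (Sum.elim (fun i => -a (reField (L i) p)) 0))
  have h1 : ∀ i, t (reField (L i) p) = a (imField (L i) p) := fun i => by
    have := b.constr_basis ℝ (Sum.elim (fun i => a (imField (L i) p))
      (Sum.elim (fun i => -a (reField (L i) p)) 0)) (Sum.inl i)
    rwa [hb] at this
  have h2 : ∀ i, t (imField (L i) p) = -a (reField (L i) p) := fun i => by
    have := b.constr_basis ℝ (Sum.elim (fun i => a (imField (L i) p))
      (Sum.elim (fun i => -a (reField (L i) p)) 0)) (Sum.inr (Sum.inl i))
    rwa [hb] at this
  have h3 : t w = 0 := by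
    have := b.constr_basis ℝ (Sum.elim (fun i => a (imField (L i) p))
      (Sum.elim (fun i => -a (reField (L i) p)) 0)) (Sum.inr (Sum.inr ()))
    rwa [hb] at this
  refine ⟨t.toContinuousLinearMap, h3, fun v hv => ?_⟩
  change t (rePart v) = _
  rw [← hspan, Submodule.mem_span_range_iff_exists_fun] at hv
  obtain ⟨c, rfl⟩ := hv
  simp only [map_sum, rePart_smul, imPart_smul, rePart_val, imPart_val, map_sub, map_add,
    map_smul, h1, h2, smul_neg, sub_neg_eq_add]

end Sections

end CRStructure

theorem contDiffAt_extdAt_apply {E : Type*} [NormedAddCommGroup E] [NormedSpace ℝ E]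
    {M : Type*} [TopologicalSpace M] [ChartedSpace E M] [IsManifold 𝓘(ℝ, E) ∞ M]
    {β : M → E →L[ℝ] ℝ} (hβ : IsSmoothForm β) {V W : M → E} (hV : IsSmoothField V)
    (hW : IsSmoothField W) (p : M) :
    ContDiffAt ℝ ∞ (fun y => extdAt β ((chartAt E p).symm y) (V ((chartAt E p).symm y))
      (W ((chartAt E p).symm y))) (chartAt E p p) := by
  refine (((contDiffAt_extd (hβ p)).clm_apply (contDiffAt_chartField hV p)).clm_apply
    (contDiffAt_chartField hW p)).congr_of_eventuallyEq ?_
  filter_upwards [(chartAt E p).open_target.mem_nhds (mem_chart_target E p)] with x hx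
  rw [hβ.extd_chartForm hx, chartField, chartField, fderiv_transition_center hx,
    fderiv_transition_center hx]

/-! ### The form θ and the computation of ω_η and ∂̄_b ω_η in terms of it. -/

namespace CRStructure

variable {n : ℕ} {M : Type*} [TopologicalSpace M] [ChartedSpace (Model n) M]
  [IsManifold 𝓘(ℝ, Model n) ∞ M] {S : CRStructure n M} {p : M}
  {η : S.Trivialization} {T : CVectorField n M}

theorem Trivialization.IsTransversal.reField_eq (hT : η.IsTransversal T) : reField T = 0 :=
  funext hT.imaginary

/-- The sign comes from η(T) = (i h)(i W) = -h(W). -/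
theorem Trivialization.IsTransversal.realForm_imField (hT : η.IsTransversal T) (p : M) :
    η.realForm p (imField T p) = -1 := by
  have h := hT.normalized p
  rw [η.ext_eq, rePart_val, imPart_val, hT.reField_eq, Pi.zero_apply, map_zero] at h
  have := congrArg Complex.re h
  simp at this
  linarith

theorem Trivialization.realForm_reField (η : S.Trivialization) {L : CVectorField n M}
    (hL : S.IsSection10 L) (p : M) : η.realForm p (reField L p) = 0 := by
  rw [← rePart_val]; exact η.realForm_rePart (hL p)

theorem Trivialization.realForm_imField (η : S.Trivialization) {L : CVectorField n M}
    (hL : S.IsSection10 L) (p : M) : η.realForm p (imField L p) = 0 := by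
  rw [← imPart_val]; exact η.realForm_imPart (hL p)

/-- The real 1-form `α` with `α (X) = dh (W, X)`, where `η = i h` and `T = i W`. -/
noncomputable def Trivialization.realAlpha (η : S.Trivialization) (T : CVectorField n M) (p : M) :
    Model n →L[ℝ] ℝ :=
  extdAt η.realForm p (imField T p)

theorem Trivialization.IsTransversal.exists_realOmega (hT : η.IsTransversal T) (p : M) :
    ∃ t : Model n →L[ℝ] ℝ, t (imField T p) = 0 ∧
      ∀ v ∈ S.T10 p, t (rePart v) = η.realAlpha T p (imPart v) :=
  η.exists_realOneForm (by rw [hT.realForm_imField]; norm_num) _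

/-- The real 1-form `θ` which is `α ∘ J` on the real part of `T^{1,0} ⊕ T^{0,1}` and vanishes on
`W`. -/
noncomputable def Trivialization.IsTransversal.realOmega (hT : η.IsTransversal T) (p : M) :
    Model n →L[ℝ] ℝ :=
  (hT.exists_realOmega p).choose

namespace Trivialization.IsTransversal

variable (hT : η.IsTransversal T)
include hT

theorem realOmega_imField (p : M) : hT.realOmega p (imField T p) = 0 :=
  (hT.exists_realOmega p).choose_spec.1

theorem realAlpha_imPart {v : CTangent n M p} (hv : v ∈ S.T10 p) :
    η.realAlpha T p (imPart v) = hT.realOmega p (rePart v) :=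
  ((hT.exists_realOmega p).choose_spec.2 v hv).symm

theorem realAlpha_rePart {v : CTangent n M p} (hv : v ∈ S.T10 p) :
    η.realAlpha T p (rePart v) = -hT.realOmega p (imPart v) := by
  have h := hT.realAlpha_imPart ((S.T10 p).smul_mem Complex.I hv)
  simpa [rePart_smul, imPart_smul] using h

/-- θ is chosen point by point, but its values on the frame Re L_i, Im L_i, W are α(Im L_i), -α(Re
L_i) and 0, all smooth. -/
theorem isSmoothForm_realOmega : IsSmoothForm hT.realOmega := by
  apply isSmoothForm_of_frame (ι := Fin n ⊕ Fin n ⊕ Unit)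
  intro p
  obtain ⟨L, hL⟩ := S.frame p
  have hmem : ∀ᶠ q in 𝓝 p, ∀ i, (L i).val q ∈ S.T10 q :=
    hL.mono fun q hq i => hq.2 ▸ Submodule.subset_span ⟨i, rfl⟩
  have hcont : Filter.Tendsto (chartAt (Model n) p).symm (𝓝 (chartAt (Model n) p p)) (𝓝 p) := by
    have := (chartAt (Model n) p).continuousAt_symm (mem_chart_target _ p)
    rwa [ContinuousAt, (chartAt (Model n) p).left_inv (mem_chart_source _ p)] at this
  refine ⟨realFrame L (imField T), ?_, ⟨η.linearIndependent_realFrame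
    (by rw [hT.realForm_imField]; norm_num) hL.self_of_nhds.1 hmem.self_of_nhds, ?_⟩, ?_⟩
  · rintro (i | i | i)
    · exact isSmoothField_reField _
    · exact isSmoothField_imField _
    · exact isSmoothField_imField _
  · simp only [Fintype.card_sum, Fintype.card_fin, Fintype.card_unit, finrank_euclideanSpace]; ring
  · rintro (i | i | i)
    · refine (contDiffAt_extdAt_apply η.isSmoothForm_realForm (isSmoothField_imField T)
        (isSmoothField_imField (L i)) p).congr_of_eventuallyEq ?_
      filter_upwards [hcont.eventually hmem] with y hy
      have := hT.realAlpha_imPart (hy i)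
      rw [rePart_val, imPart_val] at this
      exact this.symm
    · refine (contDiffAt_extdAt_apply η.isSmoothForm_realForm (isSmoothField_imField T)
        (isSmoothField_reField (L i)) p).neg.congr_of_eventuallyEq ?_
      filter_upwards [hcont.eventually hmem] with y hy
      have := hT.realAlpha_rePart (hy i)
      rw [rePart_val, imPart_val] at this
      exact (neg_eq_iff_eq_neg.2 this).symm
    · refine (contDiffAt_const (c := (0 : ℝ))).congr_of_eventuallyEq (.of_forall fun y => ?_)
      exact hT.realOmega_imField _

/-- For L = X + iY, [iW, L] = -[W, Y] + i[W, X]. As h(W), h(X) and h(Y) are constant, h([W, ·]) =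
-α(·) on X and Y, so η([T, L]) = α(X) + iα(Y). -/
theorem alpha_eq_realOmega {L : CVectorField n M} (hL : S.IsSection10 L) (p : M) :
    η.alpha T L p = -hT.realOmega p (imPart (L.val p))
      + Complex.I * hT.realOmega p (rePart (L.val p)) := by
  have key : ∀ {X : M → Model n}, IsSmoothField X → (∀ q, η.realForm q (X q) = 0) →
      η.realForm p (fieldBracket (imField T) X p) = -η.realAlpha T p (X p) := by
    intro X hX h0
    rw [realAlpha, extdAt_apply η.isSmoothForm_realForm (isSmoothField_imField T) hX,
      dirDeriv_eq_zero h0, dirDeriv_eq_zero hT.realForm_imField]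
    ring
  rw [η.alpha_eq hT hL, η.ext_eq, rePart_bracket, imPart_bracket, hT.reField_eq,
    fieldBracket_zero_left, fieldBracket_zero_left, zero_sub, zero_add, map_neg,
    key (isSmoothField_imField L) (η.realForm_imField hL),
    key (isSmoothField_reField L) (η.realForm_reField hL), ← rePart_val, ← imPart_val,
    hT.realAlpha_imPart (hL p), hT.realAlpha_rePart (hL p)]
  push_cast
  ring

theorem omega_eq [T2Space M] {u v : CTangent n M p} (hu : u ∈ S.T10 p)
    (huv : v - u ∈ S.T01 p ⊔ Submodule.span ℂ {T.val p}) :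
    η.omega T p v = -hT.realOmega p (imPart u) + Complex.I * hT.realOmega p (rePart u) := by
  obtain ⟨L, hL, hLu⟩ := exists_section hu
  have hex : ∃ L : CVectorField n M, S.IsSection10 L ∧
      v - L.val p ∈ S.T01 p ⊔ Submodule.span ℂ {T.val p} := ⟨L, hL, by rwa [hLu]⟩
  rw [Trivialization.omega, dif_pos hex]
  obtain ⟨h1, h2⟩ := hex.choose_spec
  rw [hT.alpha_eq_realOmega h1]
  -- Two candidates for the T^{1,0}-component differ by an element of T^{0,1} ⊕ ℂT. Applying η
  -- removes the T-part, and T^{1,0} ∩ T^{0,1} = 0 removes the rest.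
  suffices h : hex.choose.val p = u by rw [h]
  have hd := Submodule.sub_mem _ huv h2
  rw [sub_sub_sub_cancel_left, Submodule.mem_sup] at hd
  obtain ⟨w, hw, z, hz, hwz⟩ := hd
  obtain ⟨c, rfl⟩ := Submodule.mem_span_singleton.1 hz
  have hmem := (S.T10 p).sub_mem (h1 p) hu
  have e := congrArg (η.ext p) hwz
  have e1 : η.ext p w = 0 := η.annihilates p w (Submodule.mem_sup_right hw)
  have e2 : η.ext p (hex.choose.val p - u) = 0 :=
    η.annihilates p _ (Submodule.mem_sup_left hmem)
  rw [map_add, map_smul, e1, e2, hT.normalized, zero_add, smul_eq_mul, mul_one] at e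
  rw [e, zero_smul, add_zero] at hwz
  exact sub_eq_zero.1 (Submodule.disjoint_def.1 (S.disjoint p) _ hmem (hwz ▸ hw))

theorem omega_of_mem [T2Space M] {v : CTangent n M p} (hv : v ∈ S.T10 p) :
    η.omega T p v = -hT.realOmega p (imPart v) + Complex.I * hT.realOmega p (rePart v) :=
  hT.omega_eq hv (by rw [sub_self]; exact Submodule.zero_mem _)

/-- A purely imaginary v = u + w has w = -ū, so Im v = 2 Im u, while ω_η only sees u. It is applied
to v = [L, L̄]. -/
theorem re_omega_of_rePart_eq_zero [T2Space M] {v : CTangent n M p}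
    (hv : v ∈ S.T10 p ⊔ S.T01 p) (h0 : rePart v = 0) :
    2 * (η.omega T p v).re = -hT.realOmega p (imPart v) := by
  obtain ⟨u, hu, w, hw, rfl⟩ := Submodule.mem_sup.1 hv
  rw [hT.omega_eq hu (by rw [add_sub_cancel_left]; exact Submodule.mem_sup_left hw)]
  have h1 : conjC n M p w = -u := by
    refine eq_of_rePart_eq (S := S) hw ((S.T10 p).neg_mem hu) ?_
    rw [rePart_conjC, map_neg]
    rw [map_add] at h0
    exact eq_neg_of_add_eq_zero_right h0
  have h2 : imPart w = imPart u := by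
    have := congrArg imPart h1
    rwa [imPart_conjC, map_neg, neg_inj] at this
  rw [map_add, h2, map_add]
  simp
  ring

/-- For L = X + iY, Re L̄(ω(L)) = -X(θ(Y)) + Y(θ(X)). Moreover [L, L̄] = -2i[X, Y], which
Levi-flatness places in T^{1,0} ⊕ T^{0,1}, so Re ω([L, L̄]) = θ([X, Y]). The sum is -dθ(X, Y). -/
theorem re_dbarOmega [T2Space M] (hS : S.IsLeviFlat) (ε : ℤˣ) {L : CVectorField n M}
    (hL : S.IsSection10 L) (p : M) :
    (η.dbarOmega ε T L L p).re =
      -(((ε : ℤ) : ℝ) * extdAt hT.realOmega p (reField L p) (imField L p)) := by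
  have hb : bracket L L.conj p ∈ S.T10 p ⊔ S.T01 p :=
    ((hS p).symm ▸ hL p : L.val p ∈ S.leviNull p).2 L L hL hL rfl
  have hre : rePart (bracket L L.conj p) = 0 := by
    rw [rePart_bracket, reField_conj, imField_conj, fieldBracket_neg_right (isSmoothField_imField L)]
    have h : ∀ V : M → Model n, fieldBracket V V p = 0 := fun V => by
      simpa [← two_smul ℝ] using eq_neg_iff_add_eq_zero.1 (fieldBracket_swap V V p)
    rw [h, h, neg_zero, sub_zero]
  have him : imPart (bracket L L.conj p) = -(2 : ℝ) • fieldBracket (reField L) (imField L) p := by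
    rw [imPart_bracket, reField_conj, imField_conj, fieldBracket_neg_right (isSmoothField_imField L),
      fieldBracket_swap (imField L)]
    module
  have hom := hT.re_omega_of_rePart_eq_zero hb hre
  rw [him, map_smul, smul_eq_mul] at hom
  have hX := contDiffAt_form_apply hT.isSmoothForm_realOmega (isSmoothField_reField L) p
  have hY := contDiffAt_form_apply hT.isSmoothForm_realOmega (isSmoothField_imField L) p
  have hf : (fun q => η.omega T q (L.val q)) = fun q =>
      ((-hT.realOmega q (imField L q) : ℝ) : ℂ) + Complex.I * hT.realOmega q (reField L q) := by
    funext q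
    rw [hT.omega_of_mem (hL q), rePart_val, imPart_val]
    push_cast; rfl
  have hd : (L.conj.deriv (fun q => η.omega T q (L.val q)) p).re =
      -dirDeriv (fun q => hT.realOmega q (imField L q)) p (reField L p)
        + dirDeriv (fun q => hT.realOmega q (reField L q)) p (imField L p) := by
    have hr := realDiff_add_I_mul (n := n) (p := p) (a := fun q => -hT.realOmega q (imField L q))
      (b := fun q => hT.realOmega q (reField L q)) hY.neg hX
    have e : L.conj.deriv (fun q => η.omega T q (L.val q)) p =
        realDiff (n := n) (fun q => η.omega T q (L.val q)) p (reField L p)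
          + Complex.I * realDiff (n := n) (fun q => η.omega T q (L.val q)) p (-imField L p) := rfl
    have en : ∀ v : Model n, dirDeriv (fun q => -hT.realOmega q (imField L q)) p v =
        -dirDeriv (fun q => hT.realOmega q (imField L q)) p v := by
      intro v
      simp [dirDeriv]
    have en2 : ∀ f : M → ℝ, dirDeriv f p (-imField L p) = -dirDeriv f p (imField L p) := by
      intro f
      simp [dirDeriv]
    rw [e, hf]
    rw [show _ = _ from hr (reField L p), show _ = _ from hr (-imField L p), en, en2, en2]
    simp
  rw [Trivialization.dbarOmega, extdAt_apply hT.isSmoothForm_realOmega (isSmoothField_reField L)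
    (isSmoothField_imField L)]
  have hε : (((ε : ℤ) : ℂ)) = (((ε : ℤ) : ℝ) : ℂ) := by push_cast; rfl
  rw [hε, Complex.re_ofReal_mul, Complex.add_re, hd]
  have : (η.omega T p (bracket L L.conj p)).re =
    hT.realOmega p (fieldBracket (reField L) (imField L) p) := by linarith
  rw [this]
  ring

end Trivialization.IsTransversal

end CRStructure

/-! ### The contradiction in the Levi-flat case. -/

namespace CRStructure

variable {n : ℕ} {M : Type*} [TopologicalSpace M] [ChartedSpace (Model n) M]
  [IsManifold 𝓘(ℝ, Model n) ∞ M] {S : CRStructure n M} {p : M}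
  {η : S.Trivialization} {T : CVectorField n M}

/-- On a Levi-flat CR manifold the kernel of `h` is involutive. -/
theorem IsLeviFlat.extdAt_realForm_eq_zero [T2Space M] (hS : S.IsLeviFlat) (η : S.Trivialization)
    {x y : Model n} (hx : η.realForm p x = 0) (hy : η.realForm p y = 0) :
    extdAt η.realForm p x y = 0 := by
  obtain ⟨u, hu, rfl⟩ := η.exists_mem_T10 hx
  obtain ⟨v, hv, rfl⟩ := η.exists_mem_T10 hy
  obtain ⟨L, hL, rfl⟩ := exists_section hu
  obtain ⟨N, hN, rfl⟩ := exists_section hv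
  -- For L = X + iY and N = X' + iY', Levi-flatness gives h([X, X'] + [Y, Y']) = 0 and integrability
  -- gives h([X, X'] - [Y, Y']) = 0; adding them yields h([X, X']) = 0.
  have h1 := ((η.mem_sup_iff _).1 (((hS p).symm ▸ hL p : L.val p ∈ S.leviNull p).2 L N hL hN rfl)).1
  have hc : ∀ {K : CVectorField n M}, S.IsSection10 K → ∀ q, K.conj.val q ∈ S.T01 q :=
    fun {K} hK q => by rw [val_conj]; exact conjC_mem_T01 (hK q)
  have h2 := ((η.mem_sup_iff _).1 (Submodule.mem_sup_right
    (S.integrable L.conj N.conj (hc hL) (hc hN) p))).1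
  rw [rePart_bracket, reField_conj, imField_conj,
    fieldBracket_neg_right (isSmoothField_imField N), map_sub, map_neg] at h1
  rw [rePart_bracket, reField_conj, reField_conj, imField_conj, imField_conj,
    fieldBracket_neg_right (isSmoothField_imField N),
    fieldBracket_neg_left (isSmoothField_imField L), map_sub, neg_neg] at h2
  rw [rePart_val, rePart_val, extdAt_apply η.isSmoothForm_realForm (isSmoothField_reField L)
    (isSmoothField_reField N), dirDeriv_eq_zero (η.realForm_reField hL),
    dirDeriv_eq_zero (η.realForm_reField hN)]
  linarith

theorem Trivialization.IsTransversal.steinness_inequality [T2Space M] (hT : η.IsTransversal T)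
    (hS : S.IsLeviFlat) {ε : ℤˣ} {γ : ℝ} (hγ : η.IsSteinnessExponent ε T γ) {v : CTangent n M p}
    (hv : v ∈ S.T10 p) (hv0 : v ≠ 0) :
    0 < ((ε : ℤ) : ℝ) * extdAt hT.realOmega p (rePart v) (imPart v)
      - γ / (γ - 1) * (hT.realOmega p (rePart v) ^ 2 + hT.realOmega p (imPart v) ^ 2) := by
  obtain ⟨L, hL, rfl⟩ := exists_section hv
  have h := hγ p L hL ((hS p).symm ▸ hL p) hv0
  rw [Complex.mul_conj, ← Complex.ofReal_mul, Complex.sub_re, Complex.neg_re, Complex.ofReal_re,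
    hT.re_dbarOmega hS ε hL, hT.omega_of_mem (hL p), ← Complex.ofReal_neg, mul_comm Complex.I,
    Complex.normSq_add_mul_I] at h
  rw [rePart_val, imPart_val] at h ⊢
  linarith

/-- The inequality is used twice: it makes dθ nondegenerate on ker h, and it bounds the multiplier λ
of the Liouville field by |λ| < 1. -/
theorem IsLeviFlat.not_isSteinnessExponent [T2Space M] [CompactSpace M] [Nonempty M] (hn : 1 ≤ n)
    (hS : S.IsLeviFlat) (hT : η.IsTransversal T) (ε : ℤˣ) {γ : ℝ} (hγ1 : 1 < γ) :
    ¬ η.IsSteinnessExponent ε T γ := by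
  intro hγ
  have hc : 1 < γ / (γ - 1) := by rw [lt_div_iff₀ (by linarith)]; linarith
  have hε : ((ε : ℤ) : ℝ) = 1 ∨ ((ε : ℤ) : ℝ) = -1 := by
    rcases Int.units_eq_one_or ε with h | h <;> simp [h]
  have hpos : ∀ q, ∀ v ∈ S.T10 q, v ≠ 0 → _ := fun q v hv hv0 =>
    hT.steinness_inequality hS hγ (p := q) (v := v) hv hv0
  have hne : ∀ (q : M) (u : CTangent n M q), rePart u ≠ 0 → u ≠ 0 := by
    rintro q u hu rfl
    exact hu (map_zero _)
  refine false_of_liouville_expanding (M := M) (n := n) (by simp) η.isSmoothForm_realForm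
    hT.isSmoothForm_realOmega (fun q => ⟨η.realForm_ne_zero q, fun v w => extd_swap _ _ _ _, ?_⟩)
    (fun q v w hv hw => hS.extdAt_realForm_eq_zero η hv hw) ?_
  · intro v hv h0
    by_contra hv0
    obtain ⟨u, hu, rfl⟩ := η.exists_mem_T10 hv
    -- Test against the imaginary part of u, which lies in ker h: dθ would vanish there, but the
    -- inequality makes ε dθ positive.
    have h := hpos q u hu (hne q u hv0)
    rw [h0 _ (η.realForm_imPart hu), mul_zero] at h
    nlinarith [sq_nonneg (hT.realOmega q (rePart u)), sq_nonneg (hT.realOmega q (imPart u))]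
  · intro q v lam hv hθ hlam
    have hn' : (1 : ℝ) ≤ n := by exact_mod_cast hn
    -- Evaluate dh(v, ·) = λ h on W: the signs from skewness and from h(W) = -1 cancel.
    have hl : η.realAlpha T q v = lam := by
      rw [Trivialization.realAlpha, extdAt, extd_swap, ← extdAt, hlam, hT.realForm_imField]
      ring
    by_cases hv0 : v = 0
    · rw [hv0, map_zero] at hl
      linarith
    · obtain ⟨u, hu, rfl⟩ := η.exists_mem_T10 hv
      have h := hpos q u hu (hne q u hv0)
      rw [hθ _ (η.realForm_imPart hu)] at h
      rw [hT.realAlpha_rePart hu] at hl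
      have hx := sq_nonneg (hT.realOmega q (rePart u))
      -- Now dθ(v, Im u) = θ(Im u) = -λ, and the inequality contains cλ² with c > 1. For ε = 1 this
      -- forces -1 < λ < 0, for ε = -1 it forces λ > 0; with n ≥ 1 both give n + λ > 0.
      rw [show hT.realOmega q (imPart u) = -lam by linarith] at h
      rcases hε with e | e <;> rw [e] at h <;> nlinarith [sq_nonneg lam]

end CRStructure

end LeviCR

theorem mainTheorem8 (n : ℕ) (hn : 1 ≤ n) (M : Type*) [TopologicalSpace M] [T2Space M]
    [CompactSpace M] [Nonempty M] [ChartedSpace (LeviCR.Model n) M]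
    [IsManifold 𝓘(ℝ, LeviCR.Model n) ∞ M] (S : LeviCR.CRStructure n M) (hS : S.IsLeviFlat)
    (ε : ℤˣ) :
    S.strongSteinnessIndex ε = ⊤ := by
  rw [LeviCR.CRStructure.strongSteinnessIndex, sInf_eq_top]
  rintro _ ⟨γ, ⟨hγ, η, -, T, hT, h⟩, rfl⟩
  exact absurd h (hS.not_isSteinnessExponent hn hT ε hγ)
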